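/- Let $\alpha\in(-1,1)$, $\rho(z)=\sqrt{1-z^2}$, and let $\Omega=\{(x,y,z)\in\mathbb R^3: x^2+y^2+z^2=1,\ \alpha<z<1\}$, with spherical coordinates $x=\sin\varphi\cos\theta$, $y=\sin\varphi\sin\theta$, $z=\cos\varphi$, and let $\Delta_{\rm S}=\frac1{\sin\varphi}\frac{\partial}{\partial\varphi}\big(\sin\varphi\frac{\partial}{\partial\varphi}\big)+\frac1{\sin^2\varphi}\frac{\partial^2}{\partial\theta^2}$. For real $a>-1$ and $b\ge 0$ put $w^{(a,b)}(z)=(z-\alpha)^a\rho(z)^b$, and let $R_n^{(a,b)}$ be the polynomial of degree $n$ with positive leading coefficient such that $(R^{(a,b)}_n)_{n\ge0}$ is orthonormal for $\langle p,q\rangle=\int_\alpha^1 p\,q\,w^{(a,b)}\,dz\big/\int_\alpha^1 w^{(a,b)}\,dz$. Let $Y_{0,0}=\frac{\sqrt2}{2}$, and for $k\ge1$ let $Y_{k,0}(x,y)=T_k(x)$ and $Y_{k,1}(x,y)=y\,U_{k-1}(x)$, with $T_k,U_k$ the Chebyshev polynomials. For $0\le k\le n$, and $i\in\{0,1\}$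 ($i=0$ if $k=0$), define on $\Omega$ $$Q^{(a)}_{n,k,i}(x,y,z)=R^{(a,2k)}_{n-k}(z)\,\rho(z)^k\,Y_{k,i}\Big(\frac{x}{\rho(z)},\frac{y}{\rho(z)}\Big).$$ Let $\mathbb Q^{(a)}_N$ be the vector of the $(N+1)^2$ functions with $n\le N$ in the Fourier-mode ordering: the blocks $k=0,1,\dots,N$ follow one another; block $0$ lists $Q^{(a)}_{n,0,0}$, $n=0,\dots,N$, and block $k\ge1$ lists $Q^{(a)}_{k,k,0},Q^{(a)}_{k,k,1},\dots,Q^{(a)}_{N,k,0},Q^{(a)}_{N,k,1}$. Let $\mathbb W_N^{(a)}=w^{(a,0)}(z)\,\mathbb Q_N^{(a)}$. A matrix with blocks $A_{j,k}$ (rows of Fourier mode $j$, columns of Fourier mode $k$) is block-diagonal if $A_{j,k}=0$ for $j\ne k$, and has sub-block-bandwidths $(\lambda,\mu)$ if in every block the entry in row $p$ and column $q$ vanishes unless $-\lambda\le q-p\le\mu$. **Theorem 1.** Let $N\ge0$ be an integer, and let $\tilde a\ge2$ be an integer. In each of the following cases, and for every integer $M$ as indicated, there is exactly one matrix that satisfies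 the stated identity on $\Omega$ for all coefficient vectors $\mathbf f\in\mathbb R^{(N+1)^2}$, where $f=(\mathbb Q_N^{(a)})^\top\mathbf f$; and this matrix is block-diagonal with the stated sub-block-bandwidths. 1. $a\ge0$, $M\ge N+1$: $\ \rho\,\frac{\partial f}{\partial\varphi}=(\mathbb Q_M^{(a+1)})^\top D_\varphi^{(a)}\mathbf f$; sub-block-bandwidths $(2,4)$. 2. $a>0$, $M\ge N+2$: $\ \rho\,\frac{\partial}{\partial\varphi}\big[w^{(a,0)}f\big]=(\mathbb W_M^{(a-1)})^\top W_\varphi^{(a)}\mathbf f$; sub-block-bandwidths $(4,2)$. 3. $a\ge0$, $M\ge N$: $\ \frac{\partial f}{\partial\theta}=(\mathbb Q_M^{(a)})^\top D_\theta\,\mathbf f$; sub-block-bandwidths $(1,1)$. 4. $a\ge0$, $M\ge N$: $\ \Delta_{\rm S}f=(\mathbb Q_M^{(a+\tilde a)})^\top\mathcal L^{(a)\to(a+\tilde a)}\mathbf f$; sub-block-bandwidths $(0,2\tilde a)$, that is, $(0,4)$ for $\tilde a=2$. 5. $a\ge2$, $a-\tilde a>-1$, $M\ge N+\tilde a$: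 $\ \Delta_{\rm S}\big(w^{(a,0)}f\big)=(\mathbb W_M^{(a-\tilde a)})^\top\mathcal L_W^{(a)\to(a-\tilde a)}\mathbf f$; sub-block-bandwidths $(2\tilde a,0)$, that is, $(4,0)$ for $\tilde a=2$. 6. $a=1$, $M\ge N+1$: $\ \Delta_{\rm S}\big(w^{(1,0)}f\big)=(\mathbb Q_M^{(1)})^\top\Delta_W^{(1)}\mathbf f$; sub-block-bandwidths $(2,2)$. -/

import Mathlib

namespace SphericalCap

open Polynomial

/-! ### The spherical cap and the differential operators -/

/-- The function `ρ(z) = √(1 - z²)`. -/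
noncomputable def rho (z : ℝ) : ℝ := Real.sqrt (1 - z ^ 2)

/-- The spherical cap `{(x, y, z) : α < z < 1, x² + y² + z² = 1}`. -/
def cap (α : ℝ) : Set (ℝ × ℝ × ℝ) :=
  {p | α < p.2.2 ∧ p.2.2 < 1 ∧ p.1 ^ 2 + p.2.1 ^ 2 + p.2.2 ^ 2 = 1}

/-- The point of the unit sphere with polar angle `φ` and azimuth `θ`. -/
noncomputable def sph (φ θ : ℝ) : ℝ × ℝ × ℝ :=
  (Real.sin φ * Real.cos θ, Real.sin φ * Real.sin θ, Real.cos φ)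

/-- The operator `ρ ∂/∂φ`, applied to a function on the cap, in spherical coordinates. -/
noncomputable def rhoDphi (f : ℝ × ℝ × ℝ → ℝ) (φ θ : ℝ) : ℝ :=
  rho (Real.cos φ) * deriv (fun s => f (sph s θ)) φ

/-- The operator `∂/∂θ`, applied to a function on the cap, in spherical coordinates. -/
noncomputable def dtheta (f : ℝ × ℝ × ℝ → ℝ) (φ θ : ℝ) : ℝ :=
  deriv (fun t => f (sph φ t)) θ

/-- The spherical Laplacian
`(1 / sin φ) ∂/∂φ (sin φ ∂/∂φ) + (1 / sin² φ) ∂²/∂θ²` in spherical coordinates. -/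
noncomputable def sphLaplacian (f : ℝ × ℝ × ℝ → ℝ) (φ θ : ℝ) : ℝ :=
  1 / Real.sin φ * deriv (fun s => Real.sin s * deriv (fun u => f (sph u θ)) s) φ
    + 1 / Real.sin φ ^ 2 * deriv (fun t => deriv (fun v => f (sph φ v)) t) θ

/-! ### One-dimensional orthonormal polynomials -/

/-- The weight `w^{(a,b)}(x) = (x - α)^a ρ(x)^b` on `(α, 1)`. -/
noncomputable def weight (α a b x : ℝ) : ℝ := (x - α) ^ a * rho x ^ b

/-- The normalising constant `ω^{(a,b)} = ∫_α^1 w^{(a,b)}`. -/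
noncomputable def weightMass (α a b : ℝ) : ℝ := ∫ x in α..1, weight α a b x

/-- The normalised inner product with weight `w^{(a,b)}`. -/
noncomputable def ip (α a b : ℝ) (p q : ℝ[X]) : ℝ :=
  1 / weightMass α a b * ∫ x in α..1, p.eval x * q.eval x * weight α a b x

/-- The monic orthogonal polynomials for `ip α a b`, by the Gram-Schmidt process. -/
noncomputable def monicOP (α a b : ℝ) (n : ℕ) : ℝ[X] :=
  X ^ n - ∑ j : Fin n,
    C (ip α a b (X ^ n) (monicOP α a b j)
        / ip α a b (monicOP α a b j) (monicOP α a b j)) * monicOP α a b j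
termination_by n
decreasing_by exact j.isLt

/-- The orthonormal polynomials `R_n^{(a,b)}` (with positive leading coefficient). -/
noncomputable def R (α a b : ℝ) (n : ℕ) : ℝ[X] :=
  C (1 / Real.sqrt (ip α a b (monicOP α a b n) (monicOP α a b n))) * monicOP α a b n

/-! ### Orthogonal polynomials on the cap -/

/-- The polynomials `Y_{0,0} = √2 / 2`, `Y_{k,0} = T_k(x)` and `Y_{k,1} = y U_{k-1}(x)`, `k ≥ 1`, on
the unit circle. (For `k = 0` only `i = 0` is used.) -/
noncomputable def Y (k i : ℕ) (x y : ℝ) : ℝ :=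
  if k = 0 then Real.sqrt 2 / 2
  else if i = 0 then (Chebyshev.T ℝ (k : ℤ)).eval x
  else y * (Chebyshev.U ℝ ((k : ℤ) - 1)).eval x

/-- `Q^{(a)}_{n,k,i}(x,y,z) = R^{(a,2k)}_{n-k}(z) ρ(z)^k Y_{k,i}(x/ρ(z), y/ρ(z))`, for `k ≤ n`. -/
noncomputable def Q (α a : ℝ) (n k i : ℕ) (p : ℝ × ℝ × ℝ) : ℝ :=
  (R α a (2 * (k : ℝ)) (n - k)).eval p.2.2 * rho p.2.2 ^ k
    * Y k i (p.1 / rho p.2.2) (p.2.1 / rho p.2.2)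

/-! ### The ordering by Fourier mode -/

/-- The number of basis functions of degree at most `N` with Fourier mode `k ≤ N`. -/
def blockSize (N k : ℕ) : ℕ := if k = 0 then N + 1 else 2 * (N - k + 1)

/-- The index set for the `(N + 1)²` basis functions of degree at most `N`: the Fourier mode `k`,
and the position within the block of mode `k`. -/
abbrev Index (N : ℕ) : Type := Σ k : Fin (N + 1), Fin (blockSize N k)

/-- The degree `n` at a given position: block `0` lists `n = 0, 1, …, N`, and block `k ≥ 1` lists
`(n, i) = (k, 0), (k, 1), (k + 1, 0), (k + 1, 1), …, (N, 0), (N, 1)`. -/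
def Index.degree {N : ℕ} (s : Index N) : ℕ :=
  if (s.1 : ℕ) = 0 then s.2 else s.1 + (s.2 : ℕ) / 2

/-- The component `i ∈ {0, 1}` at a given position. -/
def Index.component {N : ℕ} (s : Index N) : ℕ :=
  if (s.1 : ℕ) = 0 then 0 else (s.2 : ℕ) % 2

/-- The function `Q_N^{(a)}(x,y,z)ᵀ f` with coefficient vector `f`. -/
noncomputable def expand (α a : ℝ) (N : ℕ) (f : Index N → ℝ) (p : ℝ × ℝ × ℝ) : ℝ :=
  ∑ s : Index N, f s * Q α a s.degree s.1 s.component p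

/-- The function `W_N^{(a)}(x,y,z)ᵀ f`, where `W_N^{(a)} = w^{(a,0)}(z) Q_N^{(a)}`. -/
noncomputable def expandW (α a : ℝ) (N : ℕ) (f : Index N → ℝ) (p : ℝ × ℝ × ℝ) : ℝ :=
  weight α a 0 p.2.2 * expand α a N f p

/-- `A` is the matrix of the operator `op`, acting on the coefficient vectors of the functions
`src f` and giving the coefficient vectors of an expansion `tgt`: the functions `op (src f)` and
`tgt (A f)` agree on the cap, for every `f`. -/
def IsOperatorMatrix (α : ℝ) {M N : ℕ} (op : (ℝ × ℝ × ℝ → ℝ) → ℝ → ℝ → ℝ)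
    (src : (Index N → ℝ) → ℝ × ℝ × ℝ → ℝ) (tgt : (Index M → ℝ) → ℝ × ℝ × ℝ → ℝ)
    (A : Matrix (Index M) (Index N) ℝ) : Prop :=
  ∀ f : Index N → ℝ, ∀ φ ∈ Set.Ioo 0 Real.pi, ∀ θ : ℝ, sph φ θ ∈ cap α →
    op (src f) φ θ = tgt (A.mulVec f) (sph φ θ)

/-! ### Banded and block-banded matrices -/

/-- `B` has bandwidths `(l, u)`: entries vanish more than `l` below or `u` above the diagonal. -/
def IsBanded {m n : ℕ} (l u : ℕ) (B : Matrix (Fin m) (Fin n) ℝ) : Prop :=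
  ∀ p q, B p q ≠ 0 → -(l : ℤ) ≤ (q : ℤ) - (p : ℤ) ∧ (q : ℤ) - (p : ℤ) ≤ (u : ℤ)

/-- The block of `A` for the Fourier modes `j` (rows) and `k` (columns). -/
def block {M N : ℕ} (A : Matrix (Index M) (Index N) ℝ) (j : Fin (M + 1)) (k : Fin (N + 1)) :
    Matrix (Fin (blockSize M j)) (Fin (blockSize N k)) ℝ :=
  Matrix.of fun p q => A ⟨j, p⟩ ⟨k, q⟩

/-- `A` has block-bandwidths `(l, u)`. -/
def HasBlockBandwidths {M N : ℕ} (l u : ℕ) (A : Matrix (Index M) (Index N) ℝ) : Prop :=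
  ∀ j k, block A j k ≠ 0 → -(l : ℤ) ≤ (k : ℤ) - (j : ℤ) ∧ (k : ℤ) - (j : ℤ) ≤ (u : ℤ)

/-- `A` is block-diagonal. -/
def IsBlockDiagonal {M N : ℕ} (A : Matrix (Index M) (Index N) ℝ) : Prop :=
  HasBlockBandwidths 0 0 A

/-- `A` has sub-block-bandwidths `(l, u)`: every block has bandwidths `(l, u)`. -/
def HasSubBlockBandwidths {M N : ℕ} (l u : ℕ) (A : Matrix (Index M) (Index N) ℝ) : Prop :=
  ∀ j k, IsBanded l u (block A j k)

/-- The conditions in `P` determine exactly one matrix, and this matrix is block-diagonal with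
sub-block-bandwidths `(l, u)`. -/
def DefinesBlockDiagonal {M N : ℕ} (P : Matrix (Index M) (Index N) ℝ → Prop) (l u : ℕ) : Prop :=
  (∃! A, P A) ∧ ∀ A, P A → IsBlockDiagonal A ∧ HasSubBlockBandwidths l u A

end SphericalCap

open SphericalCap

/-! In the variable z = cos φ every operator respects Fourier modes: it sends (z - α)^c p(z) ρ^k
times a mode of order k to (z - α)^e D(z) ρ^k times a mode of the same order, where D is a
polynomial depending linearly on p. A column of the matrix therefore lists the coefficients of D in
the target family R^{(b,2k)}, and the matrix is block-diagonal.

Two facts about D, with p = R_m, give the bandwidths. If the degree of D is at most m + d, the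
coefficients of index above m + d vanish. If D is orthogonal in the target weight to all polynomials
of degree below m - u, so do those of index below m - u. For the φ-derivative and the Laplacian this
orthogonality comes from integration by parts: the pairing of D with r becomes the pairing of p, in
its own weight, with an adjoint operator applied to r, and u bounds how far that adjoint raises
degrees. The boundary terms vanish by `weightIntegral_exactPoly`; the adjoints are in
`X_sub_C_mul_dphiPolyZero_mul`, `dphiPoly_mul`, `laplacianPoly_mul` and
`X_sub_C_mul_laplacianPolyZero_mul`. For ∂/∂θ one has d = u = 0, and only cosine and sine are
exchanged.

In blocks k ≥ 1 cosine and sine entries alternate, so a radial shift by d or u moves the position by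
2d or 2u. Uniqueness is the linear independence of the target family, `eq_zero_of_modeSum_eq_zero`.
All six cases go through `definesBlockDiagonal_of_modeSum`. -/

namespace SphericalCap

open Polynomial

/-! ### Weighted integrals of polynomials -/

lemma weight_nonneg {α a b x : ℝ} (hx : α ≤ x) : 0 ≤ weight α a b x :=
  mul_nonneg (Real.rpow_nonneg (by linarith) _) (Real.rpow_nonneg (Real.sqrt_nonneg _) _)

lemma weight_pos {α a b x : ℝ} (hα : -1 < α) (hx : x ∈ Set.Ioo α 1) : 0 < weight α a b x := by
  have h1 := hx.1
  have h2 := hx.2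
  have hρ : 0 < rho x := Real.sqrt_pos.2 (by nlinarith)
  exact mul_pos (Real.rpow_pos_of_pos (by linarith) _) (Real.rpow_pos_of_pos hρ _)

lemma weight_two_mul_natCast {α a x : ℝ} (hx : x ^ 2 ≤ 1) (k : ℕ) :
    weight α a (2 * (k : ℝ)) x = (x - α) ^ a * (1 - x ^ 2) ^ k := by
  have h : rho x ^ (2 * (k : ℝ)) = (1 - x ^ 2) ^ k := by
    rw [show (2 * (k : ℝ)) = ((2 * k : ℕ) : ℝ) by push_cast; ring, Real.rpow_natCast, pow_mul, rho,
      Real.sq_sqrt (by linarith)]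
  rw [weight, h]

lemma continuous_rho_rpow {b : ℝ} (hb : 0 ≤ b) : Continuous fun x => rho x ^ b := by
  refine Continuous.rpow_const ?_ fun x => Or.inr hb
  unfold rho
  fun_prop

/-- For a < 0 the weight is singular at α, but integrable since a > -1; the remaining factors are
continuous. -/
lemma intervalIntegrable_eval_mul_weight {α a b : ℝ} (ha : -1 < a) (hb : 0 ≤ b) (p : ℝ[X]) :
    IntervalIntegrable (fun x => p.eval x * weight α a b x) MeasureTheory.volume α 1 := by
  have h1 : IntervalIntegrable (fun x : ℝ => (x - α) ^ a) MeasureTheory.volume α 1 := by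
    have := (intervalIntegral.intervalIntegrable_rpow' (a := 0) (b := 1 - α) ha).comp_sub_right α
    simpa using this
  have h2 : Continuous fun x => p.eval x * rho x ^ b :=
    p.continuous.mul (continuous_rho_rpow hb)
  refine (h1.mul_continuousOn h2.continuousOn).congr fun x _ => ?_
  simp only [weight]
  ring

/-- The linear functional `p ↦ ∫_α^1 p w^{(a,b)}` on polynomials. -/
noncomputable def weightIntegral (α : ℝ) {a b : ℝ} (ha : -1 < a) (hb : 0 ≤ b) : ℝ[X] →ₗ[ℝ] ℝ where
  toFun p := ∫ x in α..1, p.eval x * weight α a b x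
  map_add' p q := by
    rw [← intervalIntegral.integral_add (intervalIntegrable_eval_mul_weight ha hb p)
      (intervalIntegrable_eval_mul_weight ha hb q)]
    simp only [eval_add, add_mul]
  map_smul' c p := by
    simp only [eval_smul, smul_eq_mul, mul_assoc, intervalIntegral.integral_const_mul,
      RingHom.id_apply]

lemma weightIntegral_sq_pos {α a b : ℝ} (hα : α ∈ Set.Ioo (-1 : ℝ) 1) (ha : -1 < a) (hb : 0 ≤ b)
    {p : ℝ[X]} (hp : p ≠ 0) : 0 < weightIntegral α ha hb (p * p) := by
  have hI := intervalIntegrable_eval_mul_weight (α := α) ha hb (p * p)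
  change 0 < ∫ x in α..1, (p * p).eval x * weight α a b x
  rw [intervalIntegral.integral_pos_iff_support_of_nonneg_ae' _ hI]
  · refine ⟨hα.2, ?_⟩
    -- The integrand is nonzero off the finitely many roots of `p`, a null set.
    have hsub : Set.Ioo α 1 \ (p.roots.toFinset : Set ℝ) ⊆
        Function.support (fun x => (p * p).eval x * weight α a b x) ∩ Set.Ioc α 1 := by
      rintro x ⟨hx, hr⟩
      refine ⟨?_, hx.1, hx.2.le⟩
      have h0 : p.eval x ≠ 0 := by simpa [hp] using hr
      simp [h0, (weight_pos (a := a) (b := b) hα.1 hx).ne']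
    refine lt_of_lt_of_le ?_ (MeasureTheory.measure_mono hsub)
    rw [MeasureTheory.measure_sdiff_null (Finset.measure_zero _ _), Real.volume_Ioo]
    simpa using hα.2
  · rw [Set.uIoc_of_le hα.2.le]
    filter_upwards [MeasureTheory.ae_restrict_mem measurableSet_Ioc] with x hx
    simp only [Pi.zero_apply, eval_mul]
    exact mul_nonneg (mul_self_nonneg _) (weight_nonneg hx.1.le)

lemma weightMass_eq {α a b : ℝ} (ha : -1 < a) (hb : 0 ≤ b) :
    weightMass α a b = weightIntegral α ha hb 1 := by
  simp [weightMass, weightIntegral]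

lemma weightMass_pos {α a b : ℝ} (hα : α ∈ Set.Ioo (-1 : ℝ) 1) (ha : -1 < a) (hb : 0 ≤ b) :
    0 < weightMass α a b := by
  rw [weightMass_eq ha hb, ← mul_one (1 : ℝ[X])]
  exact weightIntegral_sq_pos hα ha hb one_ne_zero

lemma ip_eq {α a b : ℝ} (ha : -1 < a) (hb : 0 ≤ b) (p q : ℝ[X]) :
    ip α a b p q = 1 / weightMass α a b * weightIntegral α ha hb (p * q) := by
  simp [ip, weightIntegral]

lemma ip_eq_zero_iff {α a b : ℝ} (hα : α ∈ Set.Ioo (-1 : ℝ) 1) (ha : -1 < a) (hb : 0 ≤ b)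
    (p q : ℝ[X]) : ip α a b p q = 0 ↔ weightIntegral α ha hb (p * q) = 0 := by
  have := (weightMass_pos hα ha hb).ne'
  simp [ip_eq ha hb, this]

/-- Polynomial factors of x - α can be traded for the exponent of the weight; this links the
orthogonality relations of families with different a. -/
lemma weightIntegral_X_sub_C_pow_mul {α a a' b : ℝ} (hα : α ∈ Set.Ioo (-1 : ℝ) 1) (ha : -1 < a)
    (ha' : -1 < a') (hb : 0 ≤ b) (n : ℕ) (h : a' = a + n) (p : ℝ[X]) :
    weightIntegral α ha hb ((X - C α) ^ n * p) = weightIntegral α ha' hb p := by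
  subst h
  refine intervalIntegral.integral_congr_ae (Filter.Eventually.of_forall fun x hx => ?_)
  rw [Set.uIoc_of_le hα.2.le] at hx
  have h0 : 0 < x - α := sub_pos.2 hx.1
  simp only [weight, Real.rpow_add_natCast h0.ne', eval_mul, eval_pow, eval_sub, eval_X, eval_C]
  ring

/-- The polynomial `D` with `((x - α)^c (1 - x²)^(k+1) g)' = (x - α)^(c-1) (1 - x²)^k D`. -/
noncomputable def exactPoly (α c : ℝ) (k : ℕ) (g : ℝ[X]) : ℝ[X] :=
  C c * (1 - X ^ 2) * g - C (2 * ((k : ℝ) + 1)) * X * (X - C α) * g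
    + (X - C α) * (1 - X ^ 2) * derivative g

/-- The integrand is an exact derivative, and its primitive vanishes at α because c = a + 1 > 0 and
at 1 because of the factor (1 - x²)^(k+1). -/
lemma weightIntegral_exactPoly {α a c : ℝ} (hα : α ∈ Set.Ioo (-1 : ℝ) 1) {k : ℕ}
    (ha : -1 < a) (hb : 0 ≤ 2 * (k : ℝ)) (hc : c = a + 1) (g : ℝ[X]) :
    weightIntegral α ha hb (exactPoly α c k g) = 0 := by
  subst hc
  have key := intervalIntegral.integral_eq_sub_of_hasDerivAt_of_le (a := α) (b := 1) hα.2.le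
    (f := fun x => (x - α) ^ (a + 1) * (1 - x ^ 2) ^ (k + 1) * g.eval x)
    (f' := fun x => (exactPoly α (a + 1) k g).eval x * weight α a (2 * (k : ℝ)) x) ?_ ?_
    (intervalIntegrable_eval_mul_weight ha hb _)
  · change ∫ x in α..1, _ = _
    rw [key]
    simp [Real.zero_rpow (show a + 1 ≠ 0 by linarith)]
  · refine Continuous.continuousOn ?_
    have h1 : Continuous fun x : ℝ => (x - α) ^ (a + 1) :=
      (continuous_id.sub continuous_const).rpow_const fun x => Or.inr (by linarith)
    exact (h1.mul (by fun_prop)).mul g.continuous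
  · intro x hx
    have h0 : x - α ≠ 0 := (sub_pos.2 hx.1).ne'
    have hx2 : x ^ 2 ≤ 1 := by nlinarith [hx.1, hx.2, hα.1]
    have h1 : HasDerivAt (fun x : ℝ => (x - α) ^ (a + 1)) ((a + 1) * (x - α) ^ a) x := by
      have := ((hasDerivAt_id x).sub_const α).rpow_const (p := a + 1) (Or.inl h0)
      simpa using this
    have h2 : HasDerivAt (fun x : ℝ => (1 - x ^ 2) ^ (k + 1))
        (((k : ℝ) + 1) * (1 - x ^ 2) ^ k * (-(2 * x))) x := by
      have := (((hasDerivAt_id x).pow 2).const_sub 1).pow (k + 1)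
      simpa [Pi.pow_def] using this
    have h3 := (h1.mul h2).mul (g.hasDerivAt x)
    refine h3.congr_deriv ?_
    rw [weight_two_mul_natCast hx2]
    simp only [exactPoly, eval_add, eval_sub, eval_mul, eval_C, eval_one, eval_pow, eval_X,
      Pi.mul_apply, Real.rpow_add_one h0]
    ring

/-! ### The orthonormal polynomials -/

lemma monicOP_sum_degree_lt {α a b : ℝ} {n : ℕ}
    (h : ∀ j < n, (monicOP α a b j).degree = j) :
    (∑ j : Fin n, C (ip α a b (X ^ n) (monicOP α a b j)
        / ip α a b (monicOP α a b j) (monicOP α a b j)) * monicOP α a b j).degree < n := by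
  refine (degree_sum_le _ _).trans_lt ((Finset.sup_lt_iff (WithBot.bot_lt_coe n)).2 fun j _ => ?_)
  rw [← smul_eq_C_mul]
  refine (degree_smul_le _ _).trans_lt ?_
  rw [h j j.isLt]
  exact Nat.cast_lt.2 j.isLt

lemma degree_monicOP (α a b : ℝ) (n : ℕ) : (monicOP α a b n).degree = n := by
  induction n using Nat.strong_induction_on with
  | _ n ih =>
    rw [monicOP, degree_sub_eq_left_of_degree_lt, degree_X_pow]
    rw [degree_X_pow]
    exact monicOP_sum_degree_lt ih

lemma monicOP_ne_zero (α a b : ℝ) (n : ℕ) : monicOP α a b n ≠ 0 :=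
  degree_ne_bot.mp (by simp [degree_monicOP])

lemma weightIntegral_monicOP_mul_monicOP {α a b : ℝ} (hα : α ∈ Set.Ioo (-1 : ℝ) 1) (ha : -1 < a)
    (hb : 0 ≤ b) (n : ℕ) :
    ∀ i < n, weightIntegral α ha hb (monicOP α a b n * monicOP α a b i) = 0 := by
  induction n using Nat.strong_induction_on with
  | _ n ih =>
    intro i hi
    have hmass := (weightMass_pos hα ha hb).ne'
    have hsq := (weightIntegral_sq_pos hα ha hb (monicOP_ne_zero α a b i)).ne'
    -- By induction only the projection onto index `i` survives, and it cancels the contribution of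
    -- X^n.
    rw [monicOP, sub_mul, map_sub, Finset.sum_mul, map_sum, Finset.sum_eq_single ⟨i, hi⟩]
    · rw [mul_assoc, ← smul_eq_C_mul, map_smul, ip_eq ha hb, ip_eq ha hb, smul_eq_mul]
      field_simp
      ring
    · intro j _ hj
      have hj' : (j : ℕ) ≠ i := fun h => hj (Fin.ext h)
      rw [mul_assoc, ← smul_eq_C_mul, map_smul]
      rcases lt_or_gt_of_ne hj' with h | h
      · rw [mul_comm, ih i hi j h, smul_zero]
      · rw [ih j j.isLt i h, smul_zero]
    · simp

lemma ip_monicOP_pos {α a b : ℝ} (hα : α ∈ Set.Ioo (-1 : ℝ) 1) (ha : -1 < a)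
    (hb : 0 ≤ b) (n : ℕ) : 0 < ip α a b (monicOP α a b n) (monicOP α a b n) := by
  rw [ip_eq ha hb]
  exact mul_pos (one_div_pos.2 (weightMass_pos hα ha hb))
    (weightIntegral_sq_pos hα ha hb (monicOP_ne_zero α a b n))

lemma degree_R {α a b : ℝ} (hα : α ∈ Set.Ioo (-1 : ℝ) 1) (ha : -1 < a)
    (hb : 0 ≤ b) (n : ℕ) : (R α a b n).degree = n := by
  have h := ip_monicOP_pos hα ha hb n
  rw [R, degree_C_mul, degree_monicOP]
  positivity

lemma natDegree_R {α a b : ℝ} (hα : α ∈ Set.Ioo (-1 : ℝ) 1) (ha : -1 < a)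
    (hb : 0 ≤ b) (n : ℕ) : (R α a b n).natDegree = n :=
  natDegree_eq_of_degree_eq_some (degree_R hα ha hb n)

/-- The orthonormal polynomials as a sequence of polynomials of degrees `0, 1, 2, …`. -/
noncomputable def RSequence {α a b : ℝ} (hα : α ∈ Set.Ioo (-1 : ℝ) 1) (ha : -1 < a)
    (hb : 0 ≤ b) : Polynomial.Sequence ℝ where
  elems' := R α a b
  degree_eq' := degree_R hα ha hb

lemma ip_R_R {α a b : ℝ} (hα : α ∈ Set.Ioo (-1 : ℝ) 1) (ha : -1 < a)
    (hb : 0 ≤ b) (m n : ℕ) : ip α a b (R α a b m) (R α a b n) = if m = n then 1 else 0 := by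
  have h1 : ip α a b (R α a b m) (R α a b n) =
      1 / √(ip α a b (monicOP α a b m) (monicOP α a b m)) *
      (1 / √(ip α a b (monicOP α a b n) (monicOP α a b n))) *
        ip α a b (monicOP α a b m) (monicOP α a b n) := by
    rw [ip_eq ha hb (R α a b m), ip_eq ha hb (monicOP α a b m) (monicOP α a b n), R, R,
      mul_mul_mul_comm, ← C_mul, ← smul_eq_C_mul, map_smul, smul_eq_mul]
    ring
  rw [h1]
  split_ifs with h
  · subst h
    have := ip_monicOP_pos hα ha hb m
    have h2 := Real.mul_self_sqrt this.le
    have h3 := (Real.sqrt_pos.2 this).ne'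
    field_simp
    linarith
  · have h2 : ip α a b (monicOP α a b m) (monicOP α a b n) = 0 := by
      rw [ip_eq_zero_iff hα ha hb]
      rcases lt_or_gt_of_ne h with h | h
      · rw [mul_comm]
        exact weightIntegral_monicOP_mul_monicOP hα ha hb n m h
      · exact weightIntegral_monicOP_mul_monicOP hα ha hb m n h
    rw [h2, mul_zero]

lemma exists_eq_sum_R {α a b : ℝ} (hα : α ∈ Set.Ioo (-1 : ℝ) 1) (ha : -1 < a)
    (hb : 0 ≤ b) {p : ℝ[X]} {n : ℕ} (hp : p.degree < n) :
    ∃ c : ℕ → ℝ, p = ∑ j ∈ Finset.range n, C (c j) * R α a b j := by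
  have h : p ∈ Submodule.span ℝ (RSequence hα ha hb '' Set.Iio n) := by
    rw [Polynomial.Sequence.span_degreeLT, mem_degreeLT]
    · exact hp
    · exact fun i _ => ((leadingCoeff_ne_zero.2 ((RSequence hα ha hb).ne_zero i))).isUnit
  rw [← Finset.coe_range, Submodule.mem_span_image_finset_iff_exists_fun] at h
  obtain ⟨c, hc⟩ := h
  -- The value 0 outside the range is never read.
  refine ⟨fun j => if h : j ∈ Finset.range n then c ⟨j, h⟩ else 0, ?_⟩
  rw [← hc, ← Finset.sum_coe_sort (Finset.range n)]
  refine Finset.sum_congr rfl fun j _ => ?_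
  beta_reduce
  rw [dif_pos j.2, ← smul_eq_C_mul]
  rfl

lemma weightIntegral_R_mul_of_degree_lt {α a b : ℝ} (hα : α ∈ Set.Ioo (-1 : ℝ) 1) (ha : -1 < a)
    (hb : 0 ≤ b) {p : ℝ[X]} {n : ℕ} (hp : p.degree < n) :
    weightIntegral α ha hb (R α a b n * p) = 0 := by
  obtain ⟨c, rfl⟩ := exists_eq_sum_R hα ha hb hp
  rw [Finset.mul_sum, map_sum]
  refine Finset.sum_eq_zero fun j hj => ?_
  have h := ip_R_R hα ha hb n j
  rw [if_neg (Finset.mem_range.1 hj).ne', ip_eq_zero_iff hα ha hb] at h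
  rw [mul_left_comm, ← smul_eq_C_mul, map_smul, h, smul_zero]

lemma eq_sum_ip_R {α a b : ℝ} (hα : α ∈ Set.Ioo (-1 : ℝ) 1) (ha : -1 < a)
    (hb : 0 ≤ b) {p : ℝ[X]} {n : ℕ} (hp : p.degree < n) :
    p = ∑ j ∈ Finset.range n, C (ip α a b p (R α a b j)) * R α a b j := by
  obtain ⟨c, hc⟩ := exists_eq_sum_R hα ha hb hp
  have key : ∀ j ∈ Finset.range n, ip α a b p (R α a b j) = c j := by
    intro j hj
    have h1 : ip α a b p (R α a b j) = ∑ i ∈ Finset.range n,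
        c i * ip α a b (R α a b i) (R α a b j) := by
      rw [ip_eq ha hb]
      nth_rw 1 [hc]
      rw [Finset.sum_mul, map_sum, Finset.mul_sum]
      refine Finset.sum_congr rfl fun i _ => ?_
      rw [ip_eq ha hb, mul_assoc, ← smul_eq_C_mul, map_smul, smul_eq_mul]
      ring
    simp only [h1, ip_R_R hα ha hb, mul_ite, mul_one, mul_zero, Finset.sum_ite_eq', hj, if_true]
  rw [Finset.sum_congr rfl fun j hj => by rw [key j hj]]
  exact hc

/-- Applied to Chebyshev polynomials of both kinds for the angular variable and to the orthonormal
polynomials for the radial one. -/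
lemma coeff_eq_zero_of_sum_eq_zero (S : Polynomial.Sequence ℝ) {n : ℕ} {c : ℕ → ℝ}
    (h : ∑ j ∈ Finset.range n, c j • S j = 0) {j : ℕ} (hj : j < n) : c j = 0 :=
  linearIndependent_iff'.1 S.linearIndependent _ c h j (Finset.mem_range.2 hj)

/-! ### Spherical coordinates -/

lemma sph_mem_cap_iff {α φ θ : ℝ} (hφ : φ ∈ Set.Ioo 0 Real.pi) :
    sph φ θ ∈ cap α ↔ α < Real.cos φ := by
  have h1 : Real.cos φ < 1 := by
    rw [← Real.cos_zero]
    exact Real.cos_lt_cos_of_nonneg_of_le_pi le_rfl hφ.2.le hφ.1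
  simp only [cap, sph, Set.mem_ofPred_eq, h1, true_and, and_iff_left_iff_imp]
  intro _
  linear_combination (Real.sin φ ^ 2) * Real.sin_sq_add_cos_sq θ + Real.sin_sq_add_cos_sq φ

lemma rho_cos {φ : ℝ} (hφ : φ ∈ Set.Ioo 0 Real.pi) : rho (Real.cos φ) = Real.sin φ := by
  rw [rho, ← Real.sin_sq, Real.sqrt_sq (Real.sin_pos_of_mem_Ioo hφ).le]

/-- The restriction of `Y k i` to the unit circle. -/
noncomputable def circleY (k i : ℕ) (θ : ℝ) : ℝ := Y k i (Real.cos θ) (Real.sin θ)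

lemma circleY_zero_left (i : ℕ) (θ : ℝ) : circleY 0 i θ = √2 / 2 := by simp [circleY, Y]

lemma circleY_zero_right {k : ℕ} (hk : k ≠ 0) (θ : ℝ) : circleY k 0 θ = Real.cos (k * θ) := by
  simp [circleY, Y, hk]

lemma circleY_of_ne_zero {k i : ℕ} (hk : k ≠ 0) (hi : i ≠ 0) (θ : ℝ) :
    circleY k i θ = Real.sin (k * θ) := by
  have h := Chebyshev.U_real_cos θ ((k : ℤ) - 1)
  rw [mul_comm] at h
  simpa [circleY, Y, hk, hi] using h

/-- The component of the derivative of `circleY k i`. -/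
def conjComponent (k i : ℕ) : ℕ := if k = 0 ∨ i ≠ 0 then 0 else 1

/-- The factor in the derivative of `circleY k i`. -/
def conjFactor (k i : ℕ) : ℝ := if i = 0 then -k else k

lemma hasDerivAt_circleY (k i : ℕ) (θ : ℝ) :
    HasDerivAt (circleY k i) (conjFactor k i * circleY k (conjComponent k i) θ) θ := by
  rcases eq_or_ne k 0 with rfl | hk
  · have h : circleY 0 i = fun _ => √2 / 2 := funext (circleY_zero_left i)
    rw [h]
    simpa [conjFactor] using hasDerivAt_const θ (√2 / 2)
  · have h0 : HasDerivAt (fun θ : ℝ => (k : ℝ) * θ) k θ := by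
      simpa using (hasDerivAt_id θ).const_mul (k : ℝ)
    rcases eq_or_ne i 0 with rfl | hi
    · have h : circleY k 0 = fun θ => Real.cos (k * θ) := funext (circleY_zero_right hk)
      rw [h]
      refine h0.cos.congr_deriv ?_
      simp only [conjFactor, conjComponent, hk, if_true, ne_eq, not_true, or_self, if_false,
        circleY_of_ne_zero hk one_ne_zero]
      ring
    · have h : circleY k i = fun θ => Real.sin (k * θ) := funext (circleY_of_ne_zero hk hi)
      rw [h]
      refine h0.sin.congr_deriv ?_
      simp only [conjFactor, conjComponent, hi, ne_eq, not_false_iff, or_true, if_true, if_false,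
        circleY_zero_right hk]
      ring

lemma conjFactor_mul_conjFactor (k i : ℕ) :
    conjFactor k i * conjFactor k (conjComponent k i) = -(k : ℝ) ^ 2 := by
  rcases eq_or_ne k 0 with rfl | hk <;> rcases eq_or_ne i 0 with rfl | hi <;>
    simp [conjFactor, conjComponent, *] <;> ring

/-- An equality of functions rather than of indices: `Y` treats all nonzero components alike, and
all components when k = 0. -/
lemma circleY_conjComponent_conjComponent (k i : ℕ) :
    circleY k (conjComponent k (conjComponent k i)) = circleY k i := by
  rcases eq_or_ne k 0 with rfl | hk
  · ext θ
    simp [circleY_zero_left]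
  · rcases eq_or_ne i 0 with rfl | hi
    · simp [conjComponent, hk]
    · ext θ
      simp [conjComponent, hk, hi, circleY_of_ne_zero]

lemma Q_sph {α a : ℝ} {n k i : ℕ} {φ θ : ℝ} (hφ : φ ∈ Set.Ioo 0 Real.pi) :
    Q α a n k i (sph φ θ) =
      (R α a (2 * (k : ℝ)) (n - k)).eval (Real.cos φ) * Real.sin φ ^ k * circleY k i θ := by
  have h := (Real.sin_pos_of_mem_Ioo hφ).ne'
  simp only [Q, sph, rho_cos hφ, circleY, mul_div_cancel_left₀ _ h]

/-! ### Sums over Fourier modes -/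

/-- The degree of the radial polynomial at a given position. -/
def Index.radial {N : ℕ} (s : Index N) : ℕ := s.degree - s.1

/-- The radial polynomial at a given position. -/
noncomputable def radialPoly (α a : ℝ) {N : ℕ} (s : Index N) : ℝ[X] :=
  R α a (2 * ((s.1 : ℕ) : ℝ)) s.radial

/-- The function with angular components `σ` and radial parts `(z - α)^c p(z) ρ^k`. -/
noncomputable def modeSum (α c : ℝ) {N : ℕ} (p : Index N → ℝ[X]) (σ : Index N → ℕ)
    (f : Index N → ℝ) (φ θ : ℝ) : ℝ :=
  ∑ s, f s * ((Real.cos φ - α) ^ c * (p s).eval (Real.cos φ) * Real.sin φ ^ (s.1 : ℕ)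
    * circleY s.1 (σ s) θ)

lemma rpow_mul_expand_sph {α a c : ℝ} {N : ℕ} (f : Index N → ℝ) {φ θ : ℝ}
    (hφ : φ ∈ Set.Ioo 0 Real.pi) :
    (Real.cos φ - α) ^ c * expand α a N f (sph φ θ) =
      modeSum α c (radialPoly α a) Index.component f φ θ := by
  rw [expand, modeSum, Finset.mul_sum]
  refine Finset.sum_congr rfl fun s _ => ?_
  rw [Q_sph hφ, radialPoly, Index.radial]
  ring

lemma expand_sph {α a : ℝ} {N : ℕ} (f : Index N → ℝ) {φ θ : ℝ}
    (hφ : φ ∈ Set.Ioo 0 Real.pi) :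
    expand α a N f (sph φ θ) = modeSum α 0 (radialPoly α a) Index.component f φ θ := by
  rw [← rpow_mul_expand_sph f hφ, Real.rpow_zero, one_mul]

lemma expandW_sph {α a : ℝ} {N : ℕ} (f : Index N → ℝ) {φ θ : ℝ}
    (hφ : φ ∈ Set.Ioo 0 Real.pi) :
    expandW α a N f (sph φ θ) = modeSum α a (radialPoly α a) Index.component f φ θ := by
  rw [← rpow_mul_expand_sph f hφ, expandW, weight, Real.rpow_zero, mul_one]
  rfl

lemma modeSum_congr_rpow {α c e : ℝ} {N : ℕ} {p q : Index N → ℝ[X]} {σ : Index N → ℕ} {φ : ℝ}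
    (h : ∀ s, (Real.cos φ - α) ^ c * (p s).eval (Real.cos φ) =
      (Real.cos φ - α) ^ e * (q s).eval (Real.cos φ))
    (f : Index N → ℝ) (θ : ℝ) :
    modeSum α c p σ f φ θ = modeSum α e q σ f φ θ := by
  simp only [modeSum, h]

/-! ### Differential operators on sums over Fourier modes -/

/-- The polynomial `D` such that `ρ ∂/∂φ` maps `(z - α)^c p ρ^k` to `(z - α)^(c-1) D ρ^k`. -/
noncomputable def dphiPoly (α c : ℝ) (k : ℕ) (p : ℝ[X]) : ℝ[X] :=
  (X - C α) * (C (k : ℝ) * X * p - (1 - X ^ 2) * derivative p) - C c * (1 - X ^ 2) * p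

/-- The polynomial `D` such that the spherical Laplacian maps `(z - α)^c p ρ^k` times a Fourier
mode of order `k` to `(z - α)^(c-2) D ρ^k` times this mode. -/
noncomputable def laplacianPoly (α c : ℝ) (k : ℕ) (p : ℝ[X]) : ℝ[X] :=
  (X - C α) ^ 2 * ((1 - X ^ 2) * derivative (derivative p)
      - C (2 * ((k : ℝ) + 1)) * X * derivative p - C ((k : ℝ) * (k + 1)) * p)
    + C (2 * c) * (X - C α) * (1 - X ^ 2) * derivative p
    + C (c * (c - 1)) * (1 - X ^ 2) * p
    - C (2 * ((k : ℝ) + 1) * c) * X * (X - C α) * p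

/-- This is ρ² Δ_S = (ρ ∂/∂φ)² + ∂²/∂θ² on a mode of order k, where ∂²/∂θ² acts as -k². The right
side shows that ρ² = 1 - z² divides out, so the Laplacian has polynomial radial coefficients. -/
lemma dphiPoly_dphiPoly (α c : ℝ) (k : ℕ) (p : ℝ[X]) :
    dphiPoly α (c - 1) k (dphiPoly α c k p) - C ((k : ℝ) ^ 2) * (X - C α) ^ 2 * p =
      (1 - X ^ 2) * laplacianPoly α c k p := by
  simp only [dphiPoly, laplacianPoly, derivative_sub, derivative_mul, derivative_C, derivative_X,
    derivative_one, derivative_X_pow, C_mul, C_sub, C_add, C_pow, C_1, Nat.cast_ofNat, C_ofNat]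
  simp
  ring

lemma hasDerivAt_radial {α c : ℝ} {k : ℕ} {p : ℝ[X]} {φ : ℝ} (hφ : φ ∈ Set.Ioo 0 Real.pi)
    (hα : α < Real.cos φ) :
    HasDerivAt (fun s => (Real.cos s - α) ^ c * p.eval (Real.cos s) * Real.sin s ^ k)
      ((Real.cos φ - α) ^ (c - 1) * (dphiPoly α c k p).eval (Real.cos φ) * Real.sin φ ^ k
        / Real.sin φ) φ := by
  have hs := (Real.sin_pos_of_mem_Ioo hφ).ne'
  have h0 : Real.cos φ - α ≠ 0 := (sub_pos.2 hα).ne'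
  have h1 := ((Real.hasDerivAt_cos φ).sub_const α).rpow_const (p := c) (Or.inl h0)
  have h2 := (p.hasDerivAt (Real.cos φ)).comp φ (Real.hasDerivAt_cos φ)
  have h3 := (Real.hasDerivAt_sin φ).pow k
  refine ((h1.mul h2).mul h3).congr_deriv ?_
  have h4 : (Real.cos φ - α) ^ c = (Real.cos φ - α) ^ (c - 1) * (Real.cos φ - α) := by
    rw [← Real.rpow_add_one h0, sub_add_cancel]
  -- For k = 0 the truncated exponent k - 1 is harmless, as both sides vanish.
  have h5 : (k : ℝ) * Real.sin φ ^ (k - 1) = k * Real.sin φ ^ k / Real.sin φ := by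
    cases k with
    | zero => simp
    | succ n => rw [Nat.add_sub_cancel, pow_succ]; field_simp
  simp only [h5, h4, dphiPoly, eval_sub, eval_mul, eval_C, eval_X, eval_pow, eval_one,
    Function.comp, Pi.mul_apply, Pi.pow_apply]
  field_simp
  rw [Real.cos_sq' φ]
  ring

lemma hasDerivAt_modeSum {α c : ℝ} {N : ℕ} {p : Index N → ℝ[X]} {σ : Index N → ℕ}
    {f : Index N → ℝ} {φ θ : ℝ} (hφ : φ ∈ Set.Ioo 0 Real.pi) (hα : α < Real.cos φ) :
    HasDerivAt (fun s => modeSum α c p σ f s θ)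
      (modeSum α (c - 1) (fun s => dphiPoly α c s.1 (p s)) σ f φ θ / Real.sin φ) φ := by
  unfold modeSum
  rw [Finset.sum_div]
  refine HasDerivAt.fun_sum fun s _ => ?_
  refine (((hasDerivAt_radial hφ hα).mul_const _).const_mul (f s)).congr_deriv ?_
  ring

lemma hasDerivAt_modeSum_angle {α c : ℝ} {N : ℕ} {p : Index N → ℝ[X]} {σ : Index N → ℕ}
    {f : Index N → ℝ} {φ θ : ℝ} :
    HasDerivAt (fun t => modeSum α c p σ f φ t)
      (modeSum α c (fun s => C (conjFactor s.1 (σ s)) * p s) (fun s => conjComponent s.1 (σ s))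
        f φ θ) θ := by
  unfold modeSum
  refine HasDerivAt.fun_sum fun s _ => ?_
  refine (((hasDerivAt_circleY s.1 (σ s) θ).const_mul _).const_mul (f s)).congr_deriv ?_
  rw [eval_mul, eval_C]
  ring

/-- The function `F` is the sum over Fourier modes `modeSum α c p σ f` on the cap. -/
def EqModeSum (F : ℝ × ℝ × ℝ → ℝ) (α c : ℝ) {N : ℕ} (p : Index N → ℝ[X]) (σ : Index N → ℕ)
    (f : Index N → ℝ) : Prop :=
  ∀ φ ∈ Set.Ioo 0 Real.pi, α < Real.cos φ → ∀ θ, F (sph φ θ) = modeSum α c p σ f φ θ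

/-- The cap condition is open in φ, so identities valid on the cap may be differentiated there. -/
lemma eventually_mem_Ioo_and_lt_cos {α φ : ℝ} (hφ : φ ∈ Set.Ioo 0 Real.pi)
    (hα : α < Real.cos φ) :
    ∀ᶠ s in nhds φ, s ∈ Set.Ioo 0 Real.pi ∧ α < Real.cos s :=
  Filter.Eventually.and (Ioo_mem_nhds hφ.1 hφ.2) (Real.continuous_cos.continuousAt.eventually_const_lt hα)

section

variable {F : ℝ × ℝ × ℝ → ℝ} {α c : ℝ} {N : ℕ} {p : Index N → ℝ[X]} {σ : Index N → ℕ}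
  {f : Index N → ℝ}

lemma EqModeSum.sin_mul_deriv (hF : EqModeSum F α c p σ f) {φ θ : ℝ}
    (hφ : φ ∈ Set.Ioo 0 Real.pi) (hα : α < Real.cos φ) :
    Real.sin φ * deriv (fun s => F (sph s θ)) φ =
      modeSum α (c - 1) (fun s => dphiPoly α c s.1 (p s)) σ f φ θ := by
  have hs := (Real.sin_pos_of_mem_Ioo hφ).ne'
  have h : (fun s => F (sph s θ)) =ᶠ[nhds φ] fun s => modeSum α c p σ f s θ := by
    filter_upwards [eventually_mem_Ioo_and_lt_cos hφ hα] with s h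
    exact hF s h.1 h.2 θ
  rw [h.deriv_eq, (hasDerivAt_modeSum hφ hα).deriv]
  field_simp

lemma EqModeSum.rhoDphi_eq (hF : EqModeSum F α c p σ f) {φ θ : ℝ}
    (hφ : φ ∈ Set.Ioo 0 Real.pi) (hα : α < Real.cos φ) :
    rhoDphi F φ θ = modeSum α (c - 1) (fun s => dphiPoly α c s.1 (p s)) σ f φ θ := by
  rw [rhoDphi, rho_cos hφ, hF.sin_mul_deriv hφ hα]

lemma EqModeSum.dtheta_eq (hF : EqModeSum F α c p σ f) {φ θ : ℝ}
    (hφ : φ ∈ Set.Ioo 0 Real.pi) (hα : α < Real.cos φ) :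
    dtheta F φ θ = modeSum α c (fun s => C (conjFactor s.1 (σ s)) * p s)
      (fun s => conjComponent s.1 (σ s)) f φ θ := by
  rw [dtheta, funext (hF φ hφ hα), hasDerivAt_modeSum_angle.deriv]

lemma EqModeSum.sphLaplacian_eq (hF : EqModeSum F α c p σ f) {φ θ : ℝ}
    (hφ : φ ∈ Set.Ioo 0 Real.pi) (hα : α < Real.cos φ) :
    sphLaplacian F φ θ = modeSum α (c - 2) (fun s => laplacianPoly α c s.1 (p s)) σ f φ θ := by
  have hs := (Real.sin_pos_of_mem_Ioo hφ).ne'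
  have h0 : Real.cos φ - α ≠ 0 := (sub_pos.2 hα).ne'
  have h1 : (fun s => Real.sin s * deriv (fun u => F (sph u θ)) s) =ᶠ[nhds φ]
      fun s => modeSum α (c - 1) (fun s => dphiPoly α c s.1 (p s)) σ f s θ := by
    filter_upwards [eventually_mem_Ioo_and_lt_cos hφ hα] with s h
    exact hF.sin_mul_deriv h.1 h.2
  have h2 : (fun t => deriv (fun v => F (sph φ v)) t) = fun t =>
      modeSum α c (fun s => C (conjFactor s.1 (σ s)) * p s) (fun s => conjComponent s.1 (σ s))
        f φ t :=
    funext fun t => hF.dtheta_eq hφ hα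
  rw [sphLaplacian, h1.deriv_eq, (hasDerivAt_modeSum hφ hα).deriv, h2,
    hasDerivAt_modeSum_angle.deriv, modeSum, modeSum, modeSum, Finset.sum_div, Finset.mul_sum,
    Finset.mul_sum, ← Finset.sum_add_distrib]
  refine Finset.sum_congr rfl fun s _ => ?_
  have h3 := congrArg (eval (Real.cos φ)) (dphiPoly_dphiPoly α c s.1 (p s))
  have h4 : (Real.cos φ - α) ^ c = (Real.cos φ - α) ^ (c - 2) * (Real.cos φ - α) ^ 2 := by
    rw [← Real.rpow_add_natCast h0]
    norm_num
  have h5 := conjFactor_mul_conjFactor s.1 (σ s)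
  simp only [eval_sub, eval_mul, eval_C, eval_pow, eval_X, eval_one, ← Real.sin_sq] at h3
  rw [circleY_conjComponent_conjComponent, show c - 1 - 1 = c - 2 by ring]
  simp only [eval_mul, eval_C]
  rw [h4]
  field_simp
  -- `h5` turns the two θ-derivatives into -k², after which `h3` cancels sin² φ.
  linear_combination (Real.cos φ - α) ^ (c - 2) * f s * circleY s.1 (σ s) θ * h3
    + (Real.cos φ - α) ^ (c - 2) * (Real.cos φ - α) ^ 2 * f s * circleY s.1 (σ s) θ
      * (p s).eval (Real.cos φ) * h5

end

/-! ### The ordering by Fourier mode -/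

lemma Index.radial_eq {N : ℕ} (s : Index N) :
    s.radial = if (s.1 : ℕ) = 0 then (s.2 : ℕ) else (s.2 : ℕ) / 2 := by
  unfold Index.radial Index.degree
  split_ifs <;> omega

lemma Index.position_eq {N : ℕ} (s : Index N) :
    (s.2 : ℕ) = if (s.1 : ℕ) = 0 then s.radial else 2 * s.radial + s.component := by
  rw [Index.radial_eq, Index.component]
  split_ifs <;> omega

lemma Index.component_lt_two {N : ℕ} (s : Index N) : s.component < 2 := by
  unfold Index.component
  split_ifs <;> omega

lemma Index.component_eq_zero {N : ℕ} {s : Index N} (h : (s.1 : ℕ) = 0) : s.component = 0 := by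
  simp [Index.component, h]

lemma Index.radial_add_le {N : ℕ} (s : Index N) : s.radial + s.1 ≤ N := by
  have h1 := s.1.isLt
  have h2 := s.2.isLt
  rw [Index.radial_eq]
  unfold blockSize at h2
  split_ifs at h2 ⊢ <;> omega

/-- The Fourier mode, the degree of the radial polynomial and the component of a position. -/
def Index.triple {N : ℕ} (s : Index N) : ℕ × ℕ × ℕ := (s.1, s.radial, s.component)

lemma Index.triple_injective (N : ℕ) : Function.Injective (Index.triple (N := N)) := by
  intro s t h
  simp only [Index.triple, Prod.mk.injEq] at h
  have hp : (s.2 : ℕ) = t.2 := by rw [s.position_eq, t.position_eq, h.1, h.2.1, h.2.2]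
  obtain ⟨k, p⟩ := s
  obtain ⟨k', p'⟩ := t
  obtain rfl : k = k' := Fin.ext h.1
  obtain rfl : p = p' := Fin.ext hp
  rfl

lemma sum_range_two_mul (n : ℕ) (g : ℕ → ℕ → ℝ) :
    ∑ p ∈ Finset.range (2 * n), g (p / 2) (p % 2) = ∑ j ∈ Finset.range n, (g j 0 + g j 1) := by
  induction n with
  | zero => simp
  | succ n ih =>
    rw [show 2 * (n + 1) = 2 * n + 1 + 1 by ring, Finset.sum_range_succ, Finset.sum_range_succ, ih,
      Finset.sum_range_succ, show 2 * n / 2 = n by omega, show 2 * n % 2 = 0 by omega,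
      show (2 * n + 1) / 2 = n by omega, show (2 * n + 1) % 2 = 1 by omega, add_assoc]

/-- Replaces positions by mode, radial degree and component; mode 0 has only one component. -/
lemma sum_index (M : ℕ) (G : ℕ → ℕ → ℕ → ℝ) :
    ∑ t : Index M, G t.1 t.radial t.component =
      ∑ k ∈ Finset.range (M + 1), ∑ j ∈ Finset.range (M - k + 1),
        if k = 0 then G k j 0 else G k j 0 + G k j 1 := by
  rw [Fintype.sum_sigma, Finset.sum_range]
  refine Finset.sum_congr rfl fun k _ => ?_
  rcases eq_or_ne (k : ℕ) 0 with hk | hk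
  · simp only [Index.radial_eq, Index.component, hk, if_true]
    rw [← Finset.sum_range (fun j => G 0 j 0) (n := blockSize M k)]
    simp [blockSize, hk]
  · simp only [Index.radial_eq, Index.component, hk, if_false]
    rw [← sum_range_two_mul (M - k + 1) (G k),
      ← Finset.sum_range (fun p => G k (p / 2) (p % 2)) (n := blockSize M k)]
    simp [blockSize, hk]

/-! ### Uniqueness of expansions -/

lemma eq_zero_of_eval_eq_zero_on_Ioo {p : ℝ[X]} {x y : ℝ} (hxy : x < y)
    (h : ∀ z ∈ Set.Ioo x y, p.eval z = 0) : p = 0 :=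
  p.eq_zero_of_infinite_isRoot ((Set.Ioo_infinite hxy).mono h)

/-- The Chebyshev polynomials of the second kind as a sequence of polynomials of degrees
`0, 1, 2, …`. -/
noncomputable def chebyshevUSequence : Polynomial.Sequence ℝ where
  elems' n := Chebyshev.U ℝ n
  degree_eq' n := Chebyshev.degree_U_natCast ℝ n

/-- With θ = arccos z the sum is a combination of the T_k(z) vanishing on (-1, 1). -/
lemma eq_zero_of_sum_cos {n : ℕ} {u : ℕ → ℝ}
    (h : ∀ θ : ℝ, ∑ k ∈ Finset.range n, u k * Real.cos (k * θ) = 0) {k : ℕ} (hk : k < n) :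
    u k = 0 := by
  refine coeff_eq_zero_of_sum_eq_zero (Chebyshev.chebyshevTsequence ℝ) (n := n) ?_ hk
  refine eq_zero_of_eval_eq_zero_on_Ioo (by norm_num : (-1 : ℝ) < 1) fun z hz => ?_
  rw [eval_finsetSum, ← h (Real.arccos z)]
  refine Finset.sum_congr rfl fun k _ => ?_
  have := Chebyshev.T_real_cos (Real.arccos z) k
  rw [Real.cos_arccos hz.1.le hz.2.le] at this
  rw [eval_smul, smul_eq_mul]
  congr 1

/-- With θ = arccos z, dividing by sin θ ≠ 0 leaves a combination of the U_k(z) vanishing on (-1,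
1). -/
lemma eq_zero_of_sum_sin {n : ℕ} {v : ℕ → ℝ}
    (h : ∀ θ : ℝ, ∑ k ∈ Finset.range n, v k * Real.sin ((k + 1) * θ) = 0) {k : ℕ} (hk : k < n) :
    v k = 0 := by
  refine coeff_eq_zero_of_sum_eq_zero chebyshevUSequence (n := n) ?_ hk
  refine eq_zero_of_eval_eq_zero_on_Ioo (by norm_num : (-1 : ℝ) < 1) fun z hz => ?_
  have hs : Real.sin (Real.arccos z) ≠ 0 := by
    rw [Real.sin_arccos]
    exact (Real.sqrt_pos.2 (by nlinarith [hz.1, hz.2])).ne'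
  refine (mul_eq_zero.1 ?_).resolve_right hs
  rw [eval_finsetSum, Finset.sum_mul, ← h (Real.arccos z)]
  refine Finset.sum_congr rfl fun k _ => ?_
  have := Chebyshev.U_real_cos (Real.arccos z) k
  rw [Real.cos_arccos hz.1.le hz.2.le] at this
  rw [eval_smul, smul_eq_mul, mul_assoc]
  congr 1

lemma eq_zero_of_sum_circleY {n : ℕ} {u v : ℕ → ℝ}
    (h : ∀ θ : ℝ, ∑ k ∈ Finset.range n, (if k = 0 then u k * circleY k 0 θ
      else u k * circleY k 0 θ + v k * circleY k 1 θ) = 0) {k : ℕ} (hk : k < n) :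
    u k = 0 ∧ (k ≠ 0 → v k = 0) := by
  -- The constant √2/2 of mode 0 is absorbed in `u'`; mode 0 has no sine term, so `v'` is 0 there.
  set u' : ℕ → ℝ := fun k => if k = 0 then u k * (√2 / 2) else u k with hu'
  set v' : ℕ → ℝ := fun k => if k = 0 then 0 else v k with hv'
  have key : ∀ θ : ℝ, ∑ k ∈ Finset.range n, u' k * Real.cos (k * θ)
      + ∑ k ∈ Finset.range n, v' k * Real.sin (k * θ) = 0 := by
    intro θ
    rw [← Finset.sum_add_distrib, ← h θ]
    refine Finset.sum_congr rfl fun k _ => ?_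
    rcases eq_or_ne k 0 with rfl | hk
    · simp [hu', circleY_zero_left]
    · simp [hu', hv', hk, circleY_zero_right, circleY_of_ne_zero]
  -- Cosine is even and sine odd, so replacing θ by -θ separates the two sums.
  have neg : ∀ θ : ℝ, ∑ k ∈ Finset.range n, u' k * Real.cos (k * θ)
      - ∑ k ∈ Finset.range n, v' k * Real.sin (k * θ) = 0 := by
    intro θ
    simpa [← sub_eq_add_neg] using key (-θ)
  have hu : u' k = 0 := eq_zero_of_sum_cos (n := n) (fun θ => by linarith [key θ, neg θ]) hk
  refine ⟨?_, fun hk0 => ?_⟩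
  · simp only [hu'] at hu
    split_ifs at hu
    · simpa using hu
    · exact hu
  · obtain ⟨j, rfl⟩ := Nat.exists_eq_succ_of_ne_zero hk0
    obtain ⟨m, rfl⟩ := Nat.exists_eq_succ_of_ne_zero (Nat.ne_zero_of_lt hk)
    refine eq_zero_of_sum_sin (n := m) (v := fun j => v (j + 1)) (fun θ => ?_)
      (Nat.lt_of_succ_lt_succ hk)
    have h0 : ∑ k ∈ Finset.range (m + 1), v' k * Real.sin (k * θ) = 0 := by
      linarith [key θ, neg θ]
    rw [Finset.sum_range_succ'] at h0
    simpa [hv'] using h0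

/-- For fixed φ, independence of the angular functions isolates each mode and component. Letting cos
φ run over (α, 1) makes its radial polynomial zero, and independence of the R_j finishes. -/
lemma eq_zero_of_modeSum_eq_zero {α a e : ℝ} (hα : α ∈ Set.Ioo (-1 : ℝ) 1) (ha : -1 < a)
    {M : ℕ} {f : Index M → ℝ}
    (h : ∀ φ ∈ Set.Ioo 0 Real.pi, α < Real.cos φ → ∀ θ,
      modeSum α e (radialPoly α a) Index.component f φ θ = 0) : f = 0 := by
  -- Extending the coefficients by zero to all triples allows sums over ranges of naturals.
  set F : ℕ × ℕ × ℕ → ℝ := Function.extend Index.triple f 0 with hF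
  have hFf : ∀ s : Index M, f s = F s.triple := fun s =>
    ((Index.triple_injective M).extend_apply f 0 s).symm
  set q : ℕ → ℕ → ℝ[X] := fun k i =>
    ∑ j ∈ Finset.range (M - k + 1), F (k, j, i) • R α a (2 * (k : ℝ)) j with hq
  have hsum : ∀ φ ∈ Set.Ioo 0 Real.pi, α < Real.cos φ → ∀ k < M + 1,
      (q k 0).eval (Real.cos φ) = 0 ∧ (k ≠ 0 → (q k 1).eval (Real.cos φ) = 0) := by
    intro φ hφ hc k hk
    have hs := (Real.sin_pos_of_mem_Ioo hφ).ne'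
    have hw : (Real.cos φ - α) ^ e ≠ 0 := (Real.rpow_pos_of_pos (sub_pos.2 hc) e).ne'
    have := eq_zero_of_sum_circleY (n := M + 1)
      (u := fun k => (Real.cos φ - α) ^ e * (q k 0).eval (Real.cos φ) * Real.sin φ ^ k)
      (v := fun k => (Real.cos φ - α) ^ e * (q k 1).eval (Real.cos φ) * Real.sin φ ^ k)
      (fun θ => ?_) hk
    · simpa [hw, hs] using this
    · have h1 := h φ hφ hc θ
      simp only [modeSum, hFf, radialPoly, Index.triple] at h1
      rw [sum_index M (fun k j i => F (k, j, i) * ((Real.cos φ - α) ^ e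
        * (R α a (2 * (k : ℝ)) j).eval (Real.cos φ) * Real.sin φ ^ k * circleY k i θ))] at h1
      rw [← h1]
      refine Finset.sum_congr rfl fun k _ => ?_
      split_ifs with hk0
      · simp only [hq, eval_finsetSum, Finset.mul_sum, Finset.sum_mul, eval_smul, smul_eq_mul]
        refine Finset.sum_congr rfl fun j _ => ?_
        ring
      · simp only [hq, eval_finsetSum, Finset.mul_sum, Finset.sum_mul, eval_smul, smul_eq_mul,
          ← Finset.sum_add_distrib]
        refine Finset.sum_congr rfl fun j _ => ?_
        ring
  have hq0 : ∀ s : Index M, q s.1 s.component = 0 := by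
    intro s
    refine eq_zero_of_eval_eq_zero_on_Ioo hα.2 fun z hz => ?_
    have hcos : Real.cos (Real.arccos z) = z :=
      Real.cos_arccos (hα.1.trans hz.1).le hz.2.le
    have hmem : Real.arccos z ∈ Set.Ioo 0 Real.pi := by
      refine ⟨Real.arccos_pos.2 hz.2, lt_of_le_of_ne (Real.arccos_le_pi z) fun h => ?_⟩
      rw [h, Real.cos_pi] at hcos
      linarith [hα.1, hz.1]
    have := hsum _ hmem (by rw [hcos]; exact hz.1) s.1 s.1.isLt
    rw [hcos] at this
    have h2 := s.component_lt_two
    rcases eq_or_ne (s.1 : ℕ) 0 with h0 | h0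
    · rw [Index.component_eq_zero h0]
      exact this.1
    · rcases (by omega : s.component = 0 ∨ s.component = 1) with h | h <;> rw [h]
      · exact this.1
      · exact this.2 h0
  funext s
  have hb : 0 ≤ 2 * ((s.1 : ℕ) : ℝ) := by positivity
  have := s.radial_add_le
  rw [hFf]
  exact coeff_eq_zero_of_sum_eq_zero (RSequence hα ha hb)
    (c := fun j => F (s.1, j, s.component)) (hq0 s) (by omega)

/-! ### Matrices of operators -/

lemma modeSum_sub {α e : ℝ} {M : ℕ} {p : Index M → ℝ[X]} {σ : Index M → ℕ} (f g : Index M → ℝ)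
    (φ θ : ℝ) :
    modeSum α e p σ (f - g) φ θ = modeSum α e p σ f φ θ - modeSum α e p σ g φ θ := by
  simp only [modeSum, Pi.sub_apply, sub_mul, Finset.sum_sub_distrib]

/-- The matrix whose columns hold the expansions of radial polynomials `g` with angular
components `σ`. -/
noncomputable def expansionMatrix (α b : ℝ) {N : ℕ} (M : ℕ) (g : Index N → ℝ[X])
    (σ : Index N → ℕ) : Matrix (Index M) (Index N) ℝ :=
  Matrix.of fun t s => if (t.1 : ℕ) = s.1 ∧ t.component = σ s then
    ip α b (2 * ((s.1 : ℕ) : ℝ)) (g s) (radialPoly α b t) else 0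

/-- The radial degrees in block k reach M - k, and radial + k ≤ N; hence N + d ≤ M leaves room for
the whole expansion of each `g s`. -/
lemma modeSum_expansionMatrix {α b e : ℝ} (hα : α ∈ Set.Ioo (-1 : ℝ) 1) (hb : -1 < b)
    {M N d : ℕ} (hNM : N + d ≤ M) {g : Index N → ℝ[X]} {σ : Index N → ℕ}
    (hσ : ∀ s, σ s < 2) (hσ0 : ∀ s, (s.1 : ℕ) = 0 → σ s = 0)
    (hdeg : ∀ s, (g s).natDegree ≤ s.radial + d) (f : Index N → ℝ) (φ θ : ℝ) :
    modeSum α e (radialPoly α b) Index.component ((expansionMatrix α b M g σ).mulVec f) φ θ =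
      modeSum α e g σ f φ θ := by
  simp only [modeSum, Matrix.mulVec, dotProduct, Finset.sum_mul]
  rw [Finset.sum_comm]
  refine Finset.sum_congr rfl fun s _ => ?_
  have hk : 0 ≤ 2 * ((s.1 : ℕ) : ℝ) := by positivity
  have hrad := s.radial_add_le
  have hlt : (g s).degree < ((M - s.1 + 1 : ℕ) : WithBot ℕ) := by
    refine degree_le_natDegree.trans_lt (Nat.cast_lt.2 ?_)
    have := hdeg s
    omega
  have hg := congrArg (eval (Real.cos φ)) (eq_sum_ip_R hα hb hk hlt)
  simp only [eval_finsetSum, eval_mul, eval_C] at hg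
  have h1 := sum_index M (fun k j i => (if k = s.1 ∧ i = σ s then
    ip α b (2 * ((s.1 : ℕ) : ℝ)) (g s) (R α b (2 * (k : ℝ)) j) else 0) * f s *
      ((Real.cos φ - α) ^ e * (R α b (2 * (k : ℝ)) j).eval (Real.cos φ) * Real.sin φ ^ k
        * circleY k i θ))
  refine h1.trans ?_
  rw [Finset.sum_eq_single (s.1 : ℕ)]
  · rw [hg, Finset.mul_sum, Finset.sum_mul, Finset.sum_mul, Finset.mul_sum]
    refine Finset.sum_congr rfl fun j _ => ?_
    rcases eq_or_ne (s.1 : ℕ) 0 with h0 | h0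
    · rw [if_pos h0]
      simp only [hσ0 s h0, and_self, if_true]
      ring
    · rw [if_neg h0]
      rcases (by have := hσ s; omega : σ s = 0 ∨ σ s = 1) with h | h
      · simp only [h, and_self, if_true, one_ne_zero, and_false, if_false]
        ring
      · simp only [h, and_self, if_true, zero_ne_one, and_false, if_false]
        ring
  · intro k _ hne
    refine Finset.sum_eq_zero fun j _ => ?_
    simp [hne]
  · intro h
    exact absurd (Finset.mem_range.2 (by omega)) h

/-- An entry pairs `g s` with a target polynomial. Too high a row degree is excluded by the degree
of `g s`, too low a one by `horth`. -/
lemma expansionMatrix_ne_zero {α b : ℝ} (hα : α ∈ Set.Ioo (-1 : ℝ) 1) (hb : -1 < b)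
    {M N d u : ℕ} {g : Index N → ℝ[X]} {σ : Index N → ℕ}
    (hdeg : ∀ s, (g s).natDegree ≤ s.radial + d)
    (horth : ∀ (s : Index N) (r : ℝ[X]), r.natDegree + u < s.radial →
      weightIntegral α hb (b := 2 * ((s.1 : ℕ) : ℝ)) (by positivity) (g s * r) = 0)
    {t : Index M} {s : Index N} (h : expansionMatrix α b M g σ t s ≠ 0) :
    (t.1 : ℕ) = s.1 ∧ t.component = σ s ∧ t.radial ≤ s.radial + d ∧ s.radial ≤ t.radial + u := by
  simp only [expansionMatrix, Matrix.of_apply, ne_eq, ite_eq_right_iff, not_forall] at h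
  obtain ⟨⟨h1, h2⟩, h3⟩ := h
  have hk : 0 ≤ 2 * ((s.1 : ℕ) : ℝ) := by positivity
  rw [ip_eq_zero_iff hα hb hk, radialPoly, h1] at h3
  refine ⟨h1, h2, ?_, ?_⟩
  · by_contra! hlt
    refine h3 ?_
    rw [mul_comm (g s)]
    refine weightIntegral_R_mul_of_degree_lt hα hb hk
      (degree_le_natDegree.trans_lt (Nat.cast_lt.2 ?_))
    have := hdeg s
    omega
  · by_contra! hlt
    refine h3 (horth s _ ?_)
    rwa [natDegree_R hα hb hk]

theorem definesBlockDiagonal_of_modeSum {α b e : ℝ} (hα : α ∈ Set.Ioo (-1 : ℝ) 1) (hb : -1 < b)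
    {M N d u l l' : ℕ} (hNM : N + d ≤ M)
    {op : (ℝ × ℝ × ℝ → ℝ) → ℝ → ℝ → ℝ} {src : (Index N → ℝ) → ℝ × ℝ × ℝ → ℝ}
    {tgt : (Index M → ℝ) → ℝ × ℝ × ℝ → ℝ} (g : Index N → ℝ[X]) (σ : Index N → ℕ)
    (hop : ∀ f, ∀ φ ∈ Set.Ioo 0 Real.pi, α < Real.cos φ → ∀ θ,
      op (src f) φ θ = modeSum α e g σ f φ θ)
    (htgt : ∀ h, ∀ φ ∈ Set.Ioo 0 Real.pi, ∀ θ,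
      tgt h (sph φ θ) = modeSum α e (radialPoly α b) Index.component h φ θ)
    (hσ : ∀ s, σ s < 2) (hσ0 : ∀ s, (s.1 : ℕ) = 0 → σ s = 0)
    (hdeg : ∀ s, (g s).natDegree ≤ s.radial + d)
    (horth : ∀ (s : Index N) (r : ℝ[X]), r.natDegree + u < s.radial →
      weightIntegral α hb (b := 2 * ((s.1 : ℕ) : ℝ)) (by positivity) (g s * r) = 0)
    (hband : ∀ (t : Index M) (s : Index N), (t.1 : ℕ) = s.1 → t.component = σ s →
      t.radial ≤ s.radial + d → s.radial ≤ t.radial + u →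
        (t.2 : ℕ) ≤ s.2 + l ∧ (s.2 : ℕ) ≤ t.2 + l') :
    DefinesBlockDiagonal (IsOperatorMatrix α op src tgt) l l' := by
  have hA : IsOperatorMatrix α op src tgt (expansionMatrix α b M g σ) := by
    intro f φ hφ θ hc
    rw [hop f φ hφ ((sph_mem_cap_iff hφ).1 hc), htgt _ φ hφ,
      modeSum_expansionMatrix hα hb hNM hσ hσ0 hdeg]
  have huniq : ∀ B, IsOperatorMatrix α op src tgt B → B = expansionMatrix α b M g σ := by
    intro B hB
    refine Matrix.mulVec_injective (funext fun f => sub_eq_zero.1 ?_)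
    refine eq_zero_of_modeSum_eq_zero (e := e) hα hb fun φ hφ hc θ => ?_
    have hmem := (sph_mem_cap_iff (θ := θ) hφ).2 hc
    rw [modeSum_sub, ← htgt _ φ hφ, ← htgt _ φ hφ, ← hB f φ hφ θ hmem, ← hA f φ hφ θ hmem, sub_self]
  refine ⟨⟨_, hA, huniq⟩, fun B hB => ?_⟩
  rw [huniq B hB]
  refine ⟨fun j k hjk => ?_, fun j k p q hpq => ?_⟩
  · obtain ⟨p, q, hpq⟩ : ∃ p q, block (expansionMatrix α b M g σ) j k p q ≠ 0 := by
      by_contra! h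
      exact hjk (Matrix.ext h)
    have := (expansionMatrix_ne_zero hα hb hdeg horth hpq).1
    simp only at this
    omega
  · obtain ⟨h1, h2, h3, h4⟩ := expansionMatrix_ne_zero hα hb hdeg horth hpq
    have := hband _ _ h1 h2 h3 h4
    simp only at this
    omega

/-- The component is preserved, so positions shift by twice the radial shift when k ≥ 1, and by the
radial shift itself when k = 0. -/
theorem definesBlockDiagonal_of_modeSum_component {α b e : ℝ} (hα : α ∈ Set.Ioo (-1 : ℝ) 1)
    (hb : -1 < b) {M N d u l l' : ℕ} (hNM : N + d ≤ M)
    {op : (ℝ × ℝ × ℝ → ℝ) → ℝ → ℝ → ℝ} {src : (Index N → ℝ) → ℝ × ℝ × ℝ → ℝ}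
    {tgt : (Index M → ℝ) → ℝ × ℝ × ℝ → ℝ} (g : Index N → ℝ[X])
    (hop : ∀ f, ∀ φ ∈ Set.Ioo 0 Real.pi, α < Real.cos φ → ∀ θ,
      op (src f) φ θ = modeSum α e g Index.component f φ θ)
    (htgt : ∀ h, ∀ φ ∈ Set.Ioo 0 Real.pi, ∀ θ,
      tgt h (sph φ θ) = modeSum α e (radialPoly α b) Index.component h φ θ)
    (hdeg : ∀ s, (g s).natDegree ≤ s.radial + d)
    (horth : ∀ (s : Index N) (r : ℝ[X]), r.natDegree + u < s.radial →
      weightIntegral α hb (b := 2 * ((s.1 : ℕ) : ℝ)) (by positivity) (g s * r) = 0)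
    (hl : l = 2 * d) (hl' : l' = 2 * u) :
    DefinesBlockDiagonal (IsOperatorMatrix α op src tgt) l l' := by
  refine definesBlockDiagonal_of_modeSum hα hb hNM g Index.component hop htgt
    Index.component_lt_two (fun s => Index.component_eq_zero) hdeg horth fun t s h1 h2 h3 h4 => ?_
  rw [t.position_eq, s.position_eq, h1, h2]
  split_ifs <;> omega

/-! ### Polynomial forms of the operators -/

/-- The polynomial `D` such that `ρ ∂/∂φ` maps `p ρ^k` to `D ρ^k`. -/
noncomputable def dphiPolyZero (k : ℕ) (p : ℝ[X]) : ℝ[X] :=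
  C (k : ℝ) * X * p - (1 - X ^ 2) * derivative p

/-- The polynomial `D` such that the spherical Laplacian maps `p ρ^k` times a Fourier mode of
order `k` to `D ρ^k` times this mode. -/
noncomputable def laplacianPolyZero (k : ℕ) (p : ℝ[X]) : ℝ[X] :=
  (1 - X ^ 2) * derivative (derivative p) - C (2 * ((k : ℝ) + 1)) * X * derivative p
    - C ((k : ℝ) * (k + 1)) * p

lemma dphiPoly_zero (α : ℝ) (k : ℕ) (p : ℝ[X]) :
    dphiPoly α 0 k p = (X - C α) * dphiPolyZero k p := by
  simp [dphiPoly, dphiPolyZero]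

lemma laplacianPoly_zero (α : ℝ) (k : ℕ) (p : ℝ[X]) :
    laplacianPoly α 0 k p = (X - C α) ^ 2 * laplacianPolyZero k p := by
  simp [laplacianPoly, laplacianPolyZero]

lemma laplacianPoly_one (α : ℝ) (k : ℕ) (p : ℝ[X]) :
    laplacianPoly α 1 k p = (X - C α) * laplacianPolyZero k ((X - C α) * p) := by
  simp only [laplacianPoly, laplacianPolyZero, derivative_mul, derivative_sub, derivative_add,
    derivative_X, derivative_C, derivative_one, C_mul, C_sub, C_add, C_1, C_ofNat]
  simp
  ring

lemma natDegree_sub_le_of_degree_le {p q : ℝ[X]} {n : ℕ} (hp : p.natDegree ≤ n)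
    (hq : q.natDegree ≤ n) : (p - q).natDegree ≤ n :=
  (natDegree_sub_le_of_le hp hq).trans (max_self n).le

lemma natDegree_C_mul_X_le (c : ℝ) : (C c * X).natDegree ≤ 1 := by
  compute_degree

lemma natDegree_X_sub_C_mul_le {α : ℝ} {p : ℝ[X]} {n : ℕ} (hp : p.natDegree ≤ n) :
    ((X - C α) * p).natDegree ≤ n + 1 := by
  rw [add_comm]
  exact natDegree_mul_le_of_le (natDegree_X_sub_C_le α) hp

lemma natDegree_X_sub_C_pow_mul_le {α : ℝ} {p : ℝ[X]} {n : ℕ} (j : ℕ) (hp : p.natDegree ≤ n) :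
    ((X - C α) ^ j * p).natDegree ≤ n + j := by
  rw [add_comm]
  refine natDegree_mul_le_of_le ?_ hp
  exact (natDegree_pow_le_of_le j (natDegree_X_sub_C_le α)).trans (by omega)

lemma natDegree_one_sub_X_sq_mul_le {p : ℝ[X]} {n : ℕ} (hp : p.natDegree ≤ n) :
    ((1 - X ^ 2) * p).natDegree ≤ n + 2 := by
  rw [add_comm]
  refine natDegree_mul_le_of_le ?_ hp
  compute_degree

lemma natDegree_C_mul_X_mul_le {c : ℝ} {p : ℝ[X]} {n : ℕ} (hp : p.natDegree ≤ n) :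
    (C c * X * p).natDegree ≤ n + 1 := by
  rw [add_comm]
  exact natDegree_mul_le_of_le (natDegree_C_mul_X_le c) hp

lemma natDegree_C_mul_le_of_le {c : ℝ} {p : ℝ[X]} {n : ℕ} (hp : p.natDegree ≤ n) :
    (C c * p).natDegree ≤ n :=
  (natDegree_C_mul_le c p).trans hp

/-- Constants are treated apart, since the truncated bound natDegree - 1 records no drop for them;
their derivative is zero. -/
lemma natDegree_mul_derivative_le {p q : ℝ[X]} {n j : ℕ} (hq : q.natDegree ≤ j + 1)
    (hp : p.natDegree ≤ n) : (q * derivative p).natDegree ≤ n + j := by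
  rcases Nat.eq_zero_or_pos p.natDegree with h | h
  · rw [derivative_of_natDegree_zero h, mul_zero, natDegree_zero]
    exact Nat.zero_le _
  · refine (natDegree_mul_le_of_le hq (natDegree_derivative_le p)).trans ?_
    omega

lemma natDegree_mul_derivative_derivative_le {p q : ℝ[X]} {n : ℕ} (hq : q.natDegree ≤ 2)
    (hp : p.natDegree ≤ n) : (q * derivative (derivative p)).natDegree ≤ n := by
  rcases Nat.eq_zero_or_pos p.natDegree with h | h
  · simp [derivative_of_natDegree_zero h]
  · refine (natDegree_mul_derivative_le (j := 1) hq (natDegree_derivative_le p)).trans ?_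
    omega

lemma natDegree_one_sub_X_sq_le : (1 - X ^ 2 : ℝ[X]).natDegree ≤ 2 := by
  compute_degree

lemma natDegree_dphiPolyZero_le (k : ℕ) {p : ℝ[X]} {n : ℕ} (hp : p.natDegree ≤ n) :
    (dphiPolyZero k p).natDegree ≤ n + 1 :=
  natDegree_sub_le_of_degree_le (natDegree_C_mul_X_mul_le hp)
    (natDegree_mul_derivative_le natDegree_one_sub_X_sq_le hp)

lemma natDegree_dphiPoly_le (α c : ℝ) (k : ℕ) {p : ℝ[X]} {n : ℕ} (hp : p.natDegree ≤ n) :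
    (dphiPoly α c k p).natDegree ≤ n + 2 := by
  refine natDegree_sub_le_of_degree_le
    (natDegree_X_sub_C_mul_le (natDegree_dphiPolyZero_le k hp)) ?_
  rw [mul_assoc]
  exact natDegree_C_mul_le_of_le (natDegree_one_sub_X_sq_mul_le hp)

lemma natDegree_laplacianPolyZero_le (k : ℕ) {p : ℝ[X]} {n : ℕ} (hp : p.natDegree ≤ n) :
    (laplacianPolyZero k p).natDegree ≤ n :=
  natDegree_sub_le_of_degree_le (natDegree_sub_le_of_degree_le
    (natDegree_mul_derivative_derivative_le natDegree_one_sub_X_sq_le hp)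
    (natDegree_mul_derivative_le (j := 0) (natDegree_C_mul_X_le _) hp))
    (natDegree_C_mul_le_of_le hp)

lemma natDegree_laplacianPoly_le (α c : ℝ) (k : ℕ) {p : ℝ[X]} {n : ℕ} (hp : p.natDegree ≤ n) :
    (laplacianPoly α c k p).natDegree ≤ n + 2 := by
  refine natDegree_sub_le_of_degree_le (natDegree_add_le_of_degree_le (natDegree_add_le_of_degree_le
    (natDegree_X_sub_C_pow_mul_le 2 (natDegree_laplacianPolyZero_le k hp)) ?_) ?_) ?_
  · refine natDegree_mul_derivative_le ?_ hp
    rw [mul_assoc]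
    exact natDegree_C_mul_le_of_le (natDegree_X_sub_C_mul_le natDegree_one_sub_X_sq_le)
  · rw [mul_assoc]
    exact natDegree_C_mul_le_of_le (natDegree_one_sub_X_sq_mul_le hp)
  · rw [mul_assoc]
    exact natDegree_C_mul_X_mul_le (natDegree_X_sub_C_mul_le hp)

/-! ### Adjoints of the operators -/

/-- Integration by parts as a polynomial identity. Differentiating (1 - x²)^(k+1) contributes
-2(k+1)x, which combines with kx to -(k+2)x; hence the adjoint is minus the operator of index k + 2.
-/
lemma X_sub_C_mul_dphiPolyZero_mul (α c : ℝ) (k : ℕ) (p r : ℝ[X]) :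
    (X - C α) * (dphiPolyZero k p * r) =
      p * -dphiPoly α c (k + 2) r - exactPoly α c k (p * r) := by
  simp only [dphiPoly, dphiPolyZero, exactPoly, derivative_mul, C_mul, C_add, C_1, C_ofNat,
    Nat.cast_add, Nat.cast_ofNat]
  ring

lemma dphiPoly_mul (α c : ℝ) (k : ℕ) (p r : ℝ[X]) :
    dphiPoly α c k p * r =
      (X - C α) ^ 1 * (p * -dphiPolyZero (k + 2) r) - exactPoly α c k (p * r) := by
  simp only [dphiPoly, dphiPolyZero, exactPoly, derivative_mul, C_mul, C_add, C_1, C_ofNat,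
    Nat.cast_add, Nat.cast_ofNat]
  ring

/-- Green's identity: `laplacianPolyZero` is symmetric for the weight (1 - x²)^k, and
`laplacianPoly` is the same operator applied to (x - α)^c p with (x - α)^(c-2) divided out. The
exact term is the derivative of the Wronskian of (x - α)^c p and r. -/
lemma laplacianPoly_mul (α c : ℝ) (k : ℕ) (p r : ℝ[X]) :
    laplacianPoly α c k p * r = (X - C α) ^ 2 * (p * laplacianPolyZero k r) +
      exactPoly α (c - 1) k
        ((X - C α) * (derivative p * r - p * derivative r) + C c * (p * r)) := by
  simp only [laplacianPoly, laplacianPolyZero, exactPoly, derivative_mul, derivative_add,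
    derivative_sub, derivative_X, derivative_C, C_mul, C_add, C_sub, C_1, C_ofNat]
  ring

lemma X_sub_C_mul_laplacianPolyZero_mul (α : ℝ) (k : ℕ) (p r : ℝ[X]) :
    (X - C α) * (laplacianPolyZero k ((X - C α) * p) * r) =
      (X - C α) ^ 1 * (p * laplacianPolyZero k ((X - C α) * r)) +
      exactPoly α 1 k ((X - C α) * (derivative p * r - p * derivative r)) := by
  simp only [laplacianPolyZero, exactPoly, derivative_mul, derivative_add,
    derivative_sub, derivative_X, derivative_C, C_mul, C_add, C_1, C_ofNat]
  ring

section

variable {α a a' : ℝ} {k m : ℕ} {r : ℝ[X]}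

lemma weightIntegral_R_mul_of_natDegree_lt (hα : α ∈ Set.Ioo (-1 : ℝ) 1) (ha : -1 < a)
    (hk : 0 ≤ 2 * (k : ℝ)) {p : ℝ[X]} {n : ℕ} (hp : p.natDegree ≤ n) (hn : n < m) :
    weightIntegral α ha hk (R α a (2 * (k : ℝ)) m * p) = 0 :=
  weightIntegral_R_mul_of_degree_lt hα ha hk
    (degree_le_natDegree.trans_lt (Nat.cast_lt.2 (hp.trans_lt hn)))

lemma weightIntegral_dphiPolyZero_R (hα : α ∈ Set.Ioo (-1 : ℝ) 1) (ha : -1 < a)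
    (ha' : -1 < a') (h : a' = a + 1) (hk : 0 ≤ 2 * (k : ℝ)) (hr : r.natDegree + 2 < m) :
    weightIntegral α ha' hk (dphiPolyZero k (R α a (2 * (k : ℝ)) m) * r) = 0 := by
  rw [← weightIntegral_X_sub_C_pow_mul hα ha ha' hk 1 (by simpa using h), pow_one,
    X_sub_C_mul_dphiPolyZero_mul α a', map_sub, weightIntegral_exactPoly hα ha hk h, sub_zero]
  exact weightIntegral_R_mul_of_natDegree_lt hα ha hk
    ((natDegree_neg _).le.trans (natDegree_dphiPoly_le α _ _ le_rfl)) hr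

lemma weightIntegral_dphiPoly_R (hα : α ∈ Set.Ioo (-1 : ℝ) 1) (ha : -1 < a)
    (ha' : -1 < a') (h : a = a' + 1) (hk : 0 ≤ 2 * (k : ℝ)) (hr : r.natDegree + 1 < m) :
    weightIntegral α ha' hk (dphiPoly α a k (R α a (2 * (k : ℝ)) m) * r) = 0 := by
  rw [dphiPoly_mul, map_sub, weightIntegral_exactPoly hα ha' hk h, sub_zero,
    weightIntegral_X_sub_C_pow_mul hα ha' ha hk 1 (by simpa using h)]
  exact weightIntegral_R_mul_of_natDegree_lt hα ha hk
    ((natDegree_neg _).le.trans (natDegree_dphiPolyZero_le _ le_rfl)) hr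

lemma weightIntegral_laplacianPolyZero_R (hα : α ∈ Set.Ioo (-1 : ℝ) 1) (ha : -1 < a)
    (ha' : -1 < a') {n : ℕ} (hn : 2 ≤ n) (h : a' = a + n) (hk : 0 ≤ 2 * (k : ℝ))
    (hr : r.natDegree + n < m) :
    weightIntegral α ha' hk (laplacianPolyZero k (R α a (2 * (k : ℝ)) m) * r) = 0 := by
  obtain ⟨j, rfl⟩ := Nat.exists_eq_add_of_le hn
  set p := R α a (2 * (k : ℝ)) m
  -- Green's identity with the roles exchanged: the test polynomial carries the power of x - α, with
  -- exponent a + 2, so that the weight with exponent a remains.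
  have h1 := laplacianPoly_mul α (a + 2) k ((X - C α) ^ j * r) p
  have h2 : (X - C α) ^ (2 + j) * (laplacianPolyZero k p * r) =
      p * laplacianPoly α (a + 2) k ((X - C α) ^ j * r) - exactPoly α (a + 2 - 1) k
        ((X - C α) * (derivative ((X - C α) ^ j * r) * p - (X - C α) ^ j * r * derivative p)
          + C (a + 2) * ((X - C α) ^ j * r * p)) := by
    rw [eq_sub_iff_add_eq, mul_comm p, h1]
    ring
  rw [← weightIntegral_X_sub_C_pow_mul hα ha ha' hk (2 + j) h, h2, map_sub,
    weightIntegral_exactPoly hα ha hk (by ring), sub_zero]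
  exact weightIntegral_R_mul_of_natDegree_lt hα ha hk (natDegree_laplacianPoly_le α _ _
    (natDegree_X_sub_C_pow_mul_le j le_rfl)) (by omega)

/-- The factor (x - α)^j raises the weight exponent to a - 2, which exceeds -1 as a > 1. The adjoint
is then `laplacianPolyZero`, which does not raise degrees, so there is no upper band. -/
lemma weightIntegral_laplacianPoly_R (hα : α ∈ Set.Ioo (-1 : ℝ) 1) (ha : -1 < a)
    (ha1 : 1 < a) (ha' : -1 < a') {j : ℕ} (h : a = a' + j + 2) (hk : 0 ≤ 2 * (k : ℝ))
    (hr : r.natDegree < m) :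
    weightIntegral α ha' hk
      ((X - C α) ^ j * laplacianPoly α a k (R α a (2 * (k : ℝ)) m) * r) = 0 := by
  have ha2 : -1 < a - 2 := by linarith
  rw [mul_assoc, weightIntegral_X_sub_C_pow_mul hα ha' ha2 hk j (by linarith), laplacianPoly_mul,
    map_add, weightIntegral_exactPoly hα ha2 hk (by ring), add_zero,
    weightIntegral_X_sub_C_pow_mul hα ha2 ha hk 2 (by push_cast; ring)]
  exact weightIntegral_R_mul_of_natDegree_lt hα ha hk (natDegree_laplacianPolyZero_le _ le_rfl) hr

/-- Here a - 2 = -1 is not an integrable exponent. Instead one factor x - α is taken from the weight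
with exponent 1, and Green's identity for (x - α)p and (x - α)r is used with exponent 0. -/
lemma weightIntegral_laplacianPolyZero_X_sub_C_mul_R (hα : α ∈ Set.Ioo (-1 : ℝ) 1)
    (h1 : (-1 : ℝ) < 1) (hk : 0 ≤ 2 * (k : ℝ)) (hr : r.natDegree + 1 < m) :
    weightIntegral α h1 hk
      (laplacianPolyZero k ((X - C α) * R α 1 (2 * (k : ℝ)) m) * r) = 0 := by
  have h0 : (-1 : ℝ) < 0 := by norm_num
  rw [← weightIntegral_X_sub_C_pow_mul hα h0 h1 hk 1 (by norm_num), pow_one,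
    X_sub_C_mul_laplacianPolyZero_mul, map_add, weightIntegral_exactPoly hα h0 hk (by norm_num),
    add_zero, weightIntegral_X_sub_C_pow_mul hα h0 h1 hk 1 (by norm_num)]
  exact weightIntegral_R_mul_of_natDegree_lt hα h1 hk (natDegree_laplacianPolyZero_le _
    (natDegree_X_sub_C_mul_le le_rfl)) hr

end

/-! ### The operator matrices -/

lemma natDegree_radialPoly_le {α a : ℝ} (hα : α ∈ Set.Ioo (-1 : ℝ) 1) (ha : -1 < a) {N : ℕ}
    (s : Index N) : (radialPoly α a s).natDegree ≤ s.radial :=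
  (natDegree_R hα ha (by positivity) _).le

lemma rpow_sub_natCast_mul_pow {x c e : ℝ} (hx : 0 < x) (n : ℕ) (h : e = c + n) (y : ℝ) :
    x ^ c * (x ^ n * y) = x ^ e * y := by
  rw [h, Real.rpow_add_natCast hx.ne', mul_assoc]

lemma eqModeSum_expand (α a : ℝ) {N : ℕ} (f : Index N → ℝ) :
    EqModeSum (expand α a N f) α 0 (radialPoly α a) Index.component f :=
  fun _ hφ _ _ => expand_sph f hφ

lemma eqModeSum_expandW (α a : ℝ) {N : ℕ} (f : Index N → ℝ) :
    EqModeSum (expandW α a N f) α a (radialPoly α a) Index.component f :=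
  fun _ hφ _ _ => expandW_sph f hφ

section

variable {α a : ℝ} {M N : ℕ}

theorem definesBlockDiagonal_rhoDphi_expand (hα : α ∈ Set.Ioo (-1 : ℝ) 1) (ha : 0 ≤ a)
    (hM : N + 1 ≤ M) :
    DefinesBlockDiagonal
      (IsOperatorMatrix α rhoDphi (expand α a N) (expand α (a + 1) M)) 2 4 := by
  refine definesBlockDiagonal_of_modeSum_component (e := 0) hα (by linarith) (d := 1) (u := 2) hM
    (fun s => dphiPolyZero s.1 (radialPoly α a s)) (fun f φ hφ hc θ => ?_)
    (fun h φ hφ θ => expand_sph h hφ)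
    (fun s => natDegree_dphiPolyZero_le _ (natDegree_radialPoly_le hα (by linarith) s))
    (fun s r hr => weightIntegral_dphiPolyZero_R hα (by linarith) _ rfl _ hr) rfl rfl
  rw [(eqModeSum_expand α a f).rhoDphi_eq hφ hc]
  refine modeSum_congr_rpow (fun s => ?_) f θ
  rw [dphiPoly_zero, eval_mul, eval_sub, eval_X, eval_C, ← pow_one (Real.cos φ - α)]
  simpa using rpow_sub_natCast_mul_pow (c := 0 - 1) (e := 0) (sub_pos.2 hc) 1 (by norm_num) _

theorem definesBlockDiagonal_rhoDphi_expandW (hα : α ∈ Set.Ioo (-1 : ℝ) 1) (ha : 0 < a)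
    (hM : N + 2 ≤ M) :
    DefinesBlockDiagonal
      (IsOperatorMatrix α rhoDphi (expandW α a N) (expandW α (a - 1) M)) 4 2 :=
  definesBlockDiagonal_of_modeSum_component (e := a - 1) hα (by linarith) (d := 2) (u := 1) hM
    (fun s => dphiPoly α a s.1 (radialPoly α a s))
    (fun f _ hφ hc _ => (eqModeSum_expandW α a f).rhoDphi_eq hφ hc)
    (fun h _ hφ _ => expandW_sph h hφ)
    (fun s => natDegree_dphiPoly_le _ _ _ (natDegree_radialPoly_le hα (by linarith) s))
    (fun s r hr => weightIntegral_dphiPoly_R hα (by linarith) _ (by ring) _ hr) rfl rfl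

theorem definesBlockDiagonal_dtheta_expand (hα : α ∈ Set.Ioo (-1 : ℝ) 1) (ha : 0 ≤ a)
    (hM : N ≤ M) :
    DefinesBlockDiagonal
      (IsOperatorMatrix α dtheta (expand α a N) (expand α a M)) 1 1 := by
  have ha' : -1 < a := by linarith
  refine definesBlockDiagonal_of_modeSum (e := 0) hα ha' (d := 0) (u := 0) hM
    (fun s => C (conjFactor s.1 s.component) * radialPoly α a s)
    (fun s => conjComponent s.1 s.component)
    (fun f φ hφ hc θ => (eqModeSum_expand α a f).dtheta_eq hφ hc)
    (fun h φ hφ θ => expand_sph h hφ) (fun s => ?_) (fun s hs => ?_)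
    (fun s => natDegree_C_mul_le_of_le (natDegree_radialPoly_le hα ha' s))
    (fun s r hr => ?_) fun t s h1 h2 h3 h4 => ?_
  · unfold conjComponent
    split_ifs <;> omega
  · simp [conjComponent, hs]
  · rw [mul_assoc, ← smul_eq_C_mul, map_smul]
    refine smul_eq_zero_of_right _ ?_
    exact weightIntegral_R_mul_of_natDegree_lt hα ha' _ le_rfl hr
  · have ht := t.component_lt_two
    have hs := s.component_lt_two
    rw [t.position_eq, s.position_eq, h1]
    split_ifs <;> omega

theorem definesBlockDiagonal_sphLaplacian_expand (hα : α ∈ Set.Ioo (-1 : ℝ) 1) (ha : 0 ≤ a)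
    {n : ℕ} (hn : 2 ≤ n) (hM : N ≤ M) :
    DefinesBlockDiagonal
      (IsOperatorMatrix α sphLaplacian (expand α a N) (expand α (a + n) M)) 0 (2 * n) := by
  have hn0 : (0 : ℝ) ≤ n := n.cast_nonneg
  refine definesBlockDiagonal_of_modeSum_component (e := 0) hα (by linarith) (d := 0) (u := n) hM
    (fun s => laplacianPolyZero s.1 (radialPoly α a s)) (fun f φ hφ hc θ => ?_)
    (fun h φ hφ θ => expand_sph h hφ)
    (fun s => natDegree_laplacianPolyZero_le _ (natDegree_radialPoly_le hα (by linarith) s))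
    (fun s r hr => weightIntegral_laplacianPolyZero_R hα (by linarith) _ hn rfl _ hr) rfl rfl
  rw [(eqModeSum_expand α a f).sphLaplacian_eq hφ hc]
  refine modeSum_congr_rpow (fun s => ?_) f θ
  rw [laplacianPoly_zero, eval_mul, eval_pow, eval_sub, eval_X, eval_C]
  exact rpow_sub_natCast_mul_pow (sub_pos.2 hc) 2 (by norm_num) _

theorem definesBlockDiagonal_sphLaplacian_expandW (hα : α ∈ Set.Ioo (-1 : ℝ) 1) (ha : 2 ≤ a)
    {n : ℕ} (hn : 2 ≤ n) (han : -1 < a - n) (hM : N + n ≤ M) :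
    DefinesBlockDiagonal
      (IsOperatorMatrix α sphLaplacian (expandW α a N) (expandW α (a - n) M)) (2 * n) 0 := by
  -- The Laplacian lowers the exponent of z - α by 2; the factor (z - α)^j with j = n - 2 is moved
  -- into the polynomial to reach a - n.
  obtain ⟨j, rfl⟩ := Nat.exists_eq_add_of_le' hn
  refine definesBlockDiagonal_of_modeSum_component (e := a - (j + 2 : ℕ)) hα han (d := j + 2)
    (u := 0) hM (fun s => (X - C α) ^ j * laplacianPoly α a s.1 (radialPoly α a s))
    (fun f φ hφ hc θ => ?_) (fun h φ hφ θ => expandW_sph h hφ) (fun s => ?_)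
    (fun s r hr => weightIntegral_laplacianPoly_R hα (by linarith) (by linarith) _
      (by push_cast; ring) _ hr) rfl rfl
  · rw [(eqModeSum_expandW α a f).sphLaplacian_eq hφ hc]
    refine modeSum_congr_rpow (fun s => ?_) f θ
    rw [eval_mul, eval_pow, eval_sub, eval_X, eval_C]
    exact (rpow_sub_natCast_mul_pow (sub_pos.2 hc) j (by push_cast; ring) _).symm
  · refine (natDegree_X_sub_C_pow_mul_le j (natDegree_laplacianPoly_le α a _
      (natDegree_radialPoly_le hα (by linarith) s))).trans ?_
    omega

theorem definesBlockDiagonal_sphLaplacian_expandW_one (hα : α ∈ Set.Ioo (-1 : ℝ) 1)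
    (hM : N + 1 ≤ M) :
    DefinesBlockDiagonal
      (IsOperatorMatrix α sphLaplacian (expandW α 1 N) (expand α 1 M)) 2 2 := by
  refine definesBlockDiagonal_of_modeSum_component (e := 0) hα (by norm_num) (d := 1) (u := 1) hM
    (fun s => laplacianPolyZero s.1 ((X - C α) * radialPoly α 1 s)) (fun f φ hφ hc θ => ?_)
    (fun h φ hφ θ => expand_sph h hφ)
    (fun s => natDegree_laplacianPolyZero_le _ (natDegree_X_sub_C_mul_le
      (natDegree_radialPoly_le hα (by norm_num) s)))
    (fun s r hr => weightIntegral_laplacianPolyZero_X_sub_C_mul_R hα _ _ hr) rfl rfl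
  rw [(eqModeSum_expandW α 1 f).sphLaplacian_eq hφ hc]
  refine modeSum_congr_rpow (fun s => ?_) f θ
  -- For c = 1 the term c(c - 1) vanishes, so a factor z - α cancels the prefactor (z - α)^(-1) and
  -- the target needs no weight.
  rw [laplacianPoly_one, eval_mul, eval_sub, eval_X, eval_C]
  simpa using rpow_sub_natCast_mul_pow (c := 1 - 2) (e := 0) (sub_pos.2 hc) 1 (by norm_num)
    (eval (Real.cos φ) (laplacianPolyZero s.1 ((X - C α) * radialPoly α 1 s)))

end

end SphericalCap

theorem theorem1 (α : ℝ) (hα : α ∈ Set.Ioo (-1 : ℝ) 1) (N : ℕ) :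
    -- the operator `ρ ∂/∂φ` from `Q^{(a)}` to `Q^{(a+1)}`
    (∀ a : ℝ, 0 ≤ a → ∀ M : ℕ, N + 1 ≤ M →
      DefinesBlockDiagonal
        (IsOperatorMatrix α rhoDphi (expand α a N) (expand α (a + 1) M)) 2 4) ∧
    -- the operator `ρ ∂/∂φ` from `W^{(a)}` to `W^{(a-1)}`
    (∀ a : ℝ, 0 < a → ∀ M : ℕ, N + 2 ≤ M →
      DefinesBlockDiagonal
        (IsOperatorMatrix α rhoDphi (expandW α a N) (expandW α (a - 1) M)) 4 2) ∧
    -- the operator `∂/∂θ` from `Q^{(a)}` to `Q^{(a)}`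
    (∀ a : ℝ, 0 ≤ a → ∀ M : ℕ, N ≤ M →
      DefinesBlockDiagonal
        (IsOperatorMatrix α dtheta (expand α a N) (expand α a M)) 1 1) ∧
    -- the spherical Laplacian from `Q^{(a)}` to `Q^{(a+ã)}`
    (∀ a : ℝ, 0 ≤ a → ∀ a' : ℕ, 2 ≤ a' → ∀ M : ℕ, N ≤ M →
      DefinesBlockDiagonal
        (IsOperatorMatrix α sphLaplacian (expand α a N) (expand α (a + a') M)) 0 (2 * a')) ∧
    -- the spherical Laplacian from `W^{(a)}` to `W^{(a-ã)}`
    (∀ a : ℝ, 2 ≤ a → ∀ a' : ℕ, 2 ≤ a' → -1 < a - a' → ∀ M : ℕ, N + a' ≤ M →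
      DefinesBlockDiagonal
        (IsOperatorMatrix α sphLaplacian (expandW α a N) (expandW α (a - a') M)) (2 * a') 0) ∧
    -- the spherical Laplacian from `W^{(1)}` to `Q^{(1)}`
    (∀ M : ℕ, N + 1 ≤ M →
      DefinesBlockDiagonal
        (IsOperatorMatrix α sphLaplacian (expandW α 1 N) (expand α 1 M)) 2 2) :=
  ⟨fun _ ha _ hM => definesBlockDiagonal_rhoDphi_expand hα ha hM,
    fun _ ha _ hM => definesBlockDiagonal_rhoDphi_expandW hα ha hM,
    fun _ ha _ hM => definesBlockDiagonal_dtheta_expand hα ha hM,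
    fun _ ha _ hn _ hM => definesBlockDiagonal_sphLaplacian_expand hα ha hn hM,
    fun _ ha _ hn han _ hM => definesBlockDiagonal_sphLaplacian_expandW hα ha hn han hM,
    fun _ hM => definesBlockDiagonal_sphLaplacian_expandW_one hα hM⟩
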